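/- Let $X$ be a smooth (finite-dimensional, Hausdorff, second countable) manifold with a Poisson bivector field $P\in\Gamma(X,\Lambda^2T_X)$, and write $P:T^*X\to T_X$ for contraction with it. The bundle $A=T^*X$, with anchor $P$ and bracket $[\alpha,\beta]=L_{P\alpha}\beta-\iota_{P\beta}d\alpha$, is a Lie algebroid (the Poisson Lie algebroid). Let $\mathcal X=[X/A]$ be its formal quotient stack. A $p$-form of cohomological degree $q$ on $\mathcal X$, i.e. an element of $\Omega^{p,q}_{\mathcal X}$, is an element of bidegree $(p,q)$ of the Weil algebra of $A$: a family of operators $c_i:\Gamma(A)^{q-i}\to\Omega^{p-i}(X;S^iA^*)$, $0\le i\le\min(p,q)$, that are alternating, $\mathbb R$-multilinear and satisfy the symbol relation $c_i(\alpha_1,\dots,f\alpha_{q-i})=f\,c_i(\alpha_1,\dots,\alpha_{q-i})+df\wedge \langle c_{i+1}(\alpha_1,\dots,\alpha_{q-i-1}),\alpha_{q-i}\rangle$. It carries the de Rham differential $d$ and the internal differential $\delta$ (the Lie derivative along the homological vector field of $A[1]$). Pulled back to $X$, the tangent complex $\mathbb T_{\mathcal X}$ is $A\xrightarrow{P}T_X$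 in degrees $-1,0$. A $1$-shifted symplectic structure on $\mathcal X$ is a sequence $\omega_k\in\Omega^{2+k,1-k}_{\mathcal X}$, $k\ge 0$, with $\delta\omega_0=0$ and $d\omega_k+\delta\omega_{k+1}=0$ for all $k\ge 0$, such that $\omega_0^\flat:\mathbb T_{\mathcal X}\to\mathbb T_{\mathcal X}^\vee[1]$ is a quasi-isomorphism. An isotropic structure on the quotient map $q:X\to\mathcal X$ is an element $\gamma\in\prod_{k\ge0}\Omega_X^{2+k,-k}$ with $(d+\delta)\gamma=q^*\omega$; it is Lagrangian if the induced map $\gamma^\flat:\mathbb T_{X/\mathcal X}\to T^*X$, $(v,a)\mapsto\omega_0(a,-)-\gamma_0(v,-)$ in degree $0$, is a quasi-isomorphism, where $\mathbb T_{X/\mathcal X}$ is the complex $T_X\oplus A\xrightarrow{(1,-P)}T_X$ in degrees $0,1$. Then: 1. The sequence $\omega=(\omega_0,0,0,\dots)$, where $\omega_0\in\Omega^{2,1}_{\mathcal X}$ is the operator $d:\Gamma(A)=\Omega^1(X)\to\Omega^2(X)$ with symbol $\mathrm{id}:A\to T^*X$, is a $1$-shifted symplectic structure on $\mathcal X$.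 2. $\gamma=0$ is a Lagrangian structure on the quotient map $q:X\to\mathcal X$: it is isotropic, and the induced map $\gamma^\flat:\mathbb T_{X/\mathcal X}\to T^*X$, which is $(v,\alpha)\mapsto\alpha$ in degree $0$, is a quasi-isomorphism. -/

import Mathlib

open scoped Manifold ContDiff Bundle
open CategoryTheory Bundle

universe u

noncomputable section

namespace PoissonStack

/-! ### Functions, vector fields and sections on a smooth manifold -/

section Sections

variable (E : Type u) [NormedAddCommGroup E] [NormedSpace ℝ E]
  (X : Type u) [TopologicalSpace X] [ChartedSpace E X]

/-- The ring `C^∞(X)` of smooth real functions on `X`. -/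
abbrev Fun : Type u := C^∞⟮𝓘(ℝ, E), X; 𝓘(ℝ, ℝ), ℝ⟯

/-- Smooth sections of a vector bundle `A → X` with typical fibre `F`. -/
abbrev Sec (F : Type u) [NormedAddCommGroup F] [NormedSpace ℝ F] (A : X → Type u)
    [TopologicalSpace (TotalSpace F A)] [∀ x, TopologicalSpace (A x)] [FiberBundle F A] : Type u :=
  Cₛ^∞⟮𝓘(ℝ, E); F, A⟯

/-- The cotangent bundle `T^*X`. -/
abbrev Cotangent (x : X) : Type u := TangentSpace 𝓘(ℝ, E) x →L[ℝ] Trivial X ℝ x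

variable [IsManifold 𝓘(ℝ, E) ∞ X]

/-- Smooth vector fields on `X`. -/
abbrev VF : Type u := Sec E X E (fun x : X => TangentSpace 𝓘(ℝ, E) x)

/-- Smooth `1`-forms, as sections of the cotangent bundle. -/
abbrev CoSec : Type u := Sec E X (E →L[ℝ] ℝ) (Cotangent E X)

/-- Smooth bundle maps `A → B`, as sections of the bundle `Hom(A, B)`. -/
abbrev BundleMap (F : Type u) [NormedAddCommGroup F] [NormedSpace ℝ F] (A : X → Type u)
    [∀ x, AddCommGroup (A x)] [∀ x, Module ℝ (A x)]
    [TopologicalSpace (TotalSpace F A)] [∀ x, TopologicalSpace (A x)]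
    [FiberBundle F A] [VectorBundle ℝ F A]
    (G : Type u) [NormedAddCommGroup G] [NormedSpace ℝ G] (B : X → Type u)
    [∀ x, AddCommGroup (B x)] [∀ x, Module ℝ (B x)]
    [TopologicalSpace (TotalSpace G B)] [∀ x, TopologicalSpace (B x)]
    [∀ x, IsTopologicalAddGroup (B x)] [∀ x, ContinuousSMul ℝ (B x)]
    [FiberBundle G B] [VectorBundle ℝ G B] : Type u :=
  Sec E X (F →L[ℝ] G) (fun x => A x →L[ℝ] B x)

end Sections

section ModuleStructure

variable {E : Type u} [NormedAddCommGroup E] [NormedSpace ℝ E]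
  {X : Type u} [TopologicalSpace X] [ChartedSpace E X]
  {F : Type u} [NormedAddCommGroup F] [NormedSpace ℝ F] {A : X → Type u}
  [∀ x, AddCommGroup (A x)] [∀ x, Module ℝ (A x)]
  [TopologicalSpace (TotalSpace F A)] [∀ x, TopologicalSpace (A x)]
  [FiberBundle F A] [VectorBundle ℝ F A]

/-- Multiplication of a section by a smooth function. -/
instance : SMul (Fun E X) (Sec E X F A) :=
  ⟨fun f s => ⟨fun x => f x • s x, f.contMDiff.smul_section s.contMDiff⟩⟩

theorem smul_apply (f : Fun E X) (s : Sec E X F A) (x : X) : (f • s) x = f x • s x := rfl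

/-- Sections form a module over the smooth functions. -/
instance : Module (Fun E X) (Sec E X F A) where
  one_smul s := by ext x; exact one_smul ℝ (s x)
  mul_smul f g s := by ext x; exact mul_smul (f x) (g x) (s x)
  smul_zero f := by ext x; exact smul_zero (f x)
  smul_add f s t := by ext x; exact smul_add (f x) (s x) (t x)
  add_smul f g s := by ext x; exact add_smul (f x) (g x) (s x)
  zero_smul s := by ext x; exact zero_smul ℝ (s x)

variable {G : Type u} [NormedAddCommGroup G] [NormedSpace ℝ G] {B : X → Type u}
  [∀ x, AddCommGroup (B x)] [∀ x, Module ℝ (B x)]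
  [TopologicalSpace (TotalSpace G B)] [∀ x, TopologicalSpace (B x)]
  [∀ x, IsTopologicalAddGroup (B x)] [∀ x, ContinuousSMul ℝ (B x)]
  [FiberBundle G B] [VectorBundle ℝ G B]

/-- The map on sections induced by a bundle map. -/
def onSec (φ : BundleMap E X F A G B) : Sec E X F A →ₗ[Fun E X] Sec E X G B where
  toFun s := ⟨fun x => φ x (s x), φ.contMDiff.clm_bundle_apply s.contMDiff⟩
  map_add' s t := by ext x; exact map_add (φ x) (s x) (t x)
  map_smul' f s := by ext x; exact map_smul (φ x) (f x) (s x)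

end ModuleStructure

section Calculus

variable {E : Type u} [NormedAddCommGroup E] [NormedSpace ℝ E] [FiniteDimensional ℝ E]
  {X : Type u} [TopologicalSpace X] [ChartedSpace E X] [IsManifold 𝓘(ℝ, E) ∞ X]

/-- The derivative `v(f) = df(v)` of a smooth function along a vector field. -/
def act (v : VF E X) (f : Fun E X) : Fun E X :=
  ⟨fun x => mvfderiv 𝓘(ℝ, E) f x (v x), by
    have h1 : ContMDiff 𝓘(ℝ, E).tangent 𝓘(ℝ, ℝ).tangent ∞
        (tangentMap 𝓘(ℝ, E) 𝓘(ℝ, ℝ) f) :=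
      f.contMDiff.contMDiff_tangentMap (by rfl)
    have h2 := h1.comp v.contMDiff
    intro x
    have h3 := (contMDiffAt_totalSpace.1 (h2 x)).2
    simp only [trivializationAt_model_space_apply] at h3
    exact h3⟩

/-- The Lie bracket of vector fields. -/
def lie (v w : VF E X) : VF E X :=
  ⟨VectorField.mlieBracket 𝓘(ℝ, E) v w, by
    have : CompleteSpace E := FiniteDimensional.complete ℝ E
    have : IsManifold 𝓘(ℝ, E) (((⊤ : ℕ∞) : WithTop ℕ∞) + 1) X := ‹IsManifold 𝓘(ℝ, E) ∞ X›
    have : IsManifold 𝓘(ℝ, E) (minSmoothness ℝ 2) X :=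
      IsManifold.of_le (n := ∞) (by
        rw [minSmoothness_of_isRCLikeNormedField]
        exact WithTop.coe_le_coe.2 (le_top : (2 : ℕ∞) ≤ ⊤))
    exact ContDiff.mlieBracket_vectorField (n := ⊤) (m := ⊤) v.contMDiff w.contMDiff (by simp)⟩

/-- The pairing of a `1`-form with a vector field. -/
def pair (α : CoSec E X) (v : VF E X) : Fun E X :=
  ⟨fun x => α x (v x), by
    have h : ContMDiff 𝓘(ℝ, E) (𝓘(ℝ, E).prod 𝓘(ℝ, ℝ)) ∞
        (fun x => TotalSpace.mk' ℝ (E := Trivial X ℝ) x (α x (v x))) :=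
      α.contMDiff.clm_bundle_apply v.contMDiff
    intro x
    exact (contMDiffAt_totalSpace.1 (h x)).2⟩

variable (E X) in
/-- Inhomogeneous forms on `X`, given by their values on tuples of vector fields; the
`b`-th component is the part of degree `b`. Only those families whose components are alternating and
`C^∞(X)`-multilinear (see `IsDiffForm`) are differential forms. -/
abbrev PreForm : Type u := ∀ b : ℕ, (Fin b → VF E X) → Fun E X

/-- All components are alternating and `C^∞(X)`-multilinear, i.e. are differential forms. -/
def IsDiffForm (η : PreForm E X) : Prop :=
  ∀ b, ∃ m : VF E X [⋀^Fin b]→ₗ[Fun E X] Fun E X, ∀ v, η b v = m v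

/-- The de Rham differential, by the Koszul formula
`(dη)(v₀,…,v_b) = ∑ₛ (-1)ˢ (vₛ(η(…,v̂ₛ,…)) - ∑_{t > s} η(…,v̂ₛ,…,[vₛ,vₜ],…))`. -/
def extD (η : PreForm E X) : PreForm E X
  | 0, _ => 0
  | b + 1, v => ∑ s : Fin (b + 1), (-1) ^ (s : ℕ) *
      (act (v s) (η b (s.removeNth v)) -
        ∑ t ∈ Finset.Ioi s, η b (s.removeNth (Function.update v t (lie (v s) (v t)))))

/-- The Lie derivative `L_w η` of a form along a vector field. -/
def lieD (w : VF E X) (η : PreForm E X) : PreForm E X := fun b v =>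
  act w (η b v) - ∑ t : Fin b, η b (Function.update v t (lie w (v t)))

/-- The contraction `ι_w η`. -/
def contract (w : VF E X) (η : PreForm E X) : PreForm E X := fun b v =>
  η (b + 1) (Fin.cons w v)

/-- The product `df ∧ η`. -/
def dWedge (f : Fun E X) (η : PreForm E X) : PreForm E X
  | 0, _ => 0
  | b + 1, v => ∑ s : Fin (b + 1), (-1) ^ (s : ℕ) * (act (v s) f * η b (s.removeNth v))

/-- A section of `T^*X` as a differential form. -/
def toPreForm (α : CoSec E X) : PreForm E X
  | 1, v => pair α (v 0)
  | _, _ => 0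

end Calculus

/-! ### Poisson structures -/

section Poisson

variable (E : Type u) [NormedAddCommGroup E] [NormedSpace ℝ E]
  (X : Type u) [TopologicalSpace X] [ChartedSpace E X] [IsManifold 𝓘(ℝ, E) ∞ X]

variable {E X} in
/-- The bracket `{f, g} = dg(P(df))`. -/
def poissonBracket
    (P : BundleMap E X (E →L[ℝ] ℝ) (Cotangent E X) E (fun x : X => TangentSpace 𝓘(ℝ, E) x))
    (f g : X → ℝ) : X → ℝ :=
  fun x => mvfderiv 𝓘(ℝ, E) g x (P x (mvfderiv 𝓘(ℝ, E) f x))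

/-- A Poisson structure on `X`: a smooth bivector field, given as the skew bundle map
`P : T^*X → TX` of contraction with it, whose bracket on functions satisfies the Jacobi identity. -/
structure PoissonStructure where
  /-- Contraction with the bivector field. -/
  sharp : BundleMap E X (E →L[ℝ] ℝ) (Cotangent E X) E (fun x : X => TangentSpace 𝓘(ℝ, E) x)
  skew : ∀ (x : X) (α β : Cotangent E X x), β (sharp x α) = -α (sharp x β)
  jacobi : ∀ f g h : Fun E X,
    poissonBracket sharp f (poissonBracket sharp g h) +
      poissonBracket sharp g (poissonBracket sharp h f) +
      poissonBracket sharp h (poissonBracket sharp f g) = 0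

end Poisson

/-! ### Lie algebroids and forms on their quotient stacks -/

section Algebroid

variable (E : Type u) [NormedAddCommGroup E] [NormedSpace ℝ E] [FiniteDimensional ℝ E]
  {X : Type u} [TopologicalSpace X] [ChartedSpace E X] [IsManifold 𝓘(ℝ, E) ∞ X]
  (F : Type u) [NormedAddCommGroup F] [NormedSpace ℝ F] (A : X → Type u)
  [∀ x, AddCommGroup (A x)] [∀ x, Module ℝ (A x)]
  [TopologicalSpace (TotalSpace F A)] [∀ x, TopologicalSpace (A x)]
  [FiberBundle F A] [VectorBundle ℝ F A]

/-- A Lie algebroid structure on the smooth vector bundle `A → X` of finite rank. -/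
structure LieAlgebroid [FiniteDimensional ℝ F] [ContMDiffVectorBundle ∞ F A 𝓘(ℝ, E)] where
  /-- The anchor `A → TX`. -/
  anchor : BundleMap E X F A E (fun x : X => TangentSpace 𝓘(ℝ, E) x)
  /-- The bracket of sections. -/
  bracket : Sec E X F A →ₗ[ℝ] Sec E X F A →ₗ[ℝ] Sec E X F A
  bracket_self : ∀ a, bracket a a = 0
  jacobi : ∀ a b c, bracket a (bracket b c) = bracket (bracket a b) c + bracket b (bracket a c)
  leibniz : ∀ (a b : Sec E X F A) (f : Fun E X),
    bracket a (f • b) = f • bracket a b + act (onSec anchor a) f • b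
  anchor_bracket : ∀ a b, onSec anchor (bracket a b) = lie (onSec anchor a) (onSec anchor b)

/-- Families of operators `c(α₁,…,α_a | β₁,…,β_i)` with values in forms on `X`, where the `α`'s and
`β`'s are sections of `A`. -/
abbrev PreStackForm : Type u :=
  ∀ a i : ℕ, (Fin a → Sec E X F A) → (Fin i → Sec E X F A) → PreForm E X

variable {E F A}

/-- The conditions on a family of operators to be a form on the formal quotient stack `[X/A]`, i.e. an
element of the Weil algebra of `A` (the de Rham algebra of the graded manifold `A[1]`): it is
`ℝ`-multilinear and alternating in the `α`'s, `C^∞(X)`-multilinear and symmetric in the `β`'s, has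
values in differential forms, and its behaviour under `α_a ↦ f α_a` is governed by its symbol,
`c(α₁,…,f α_a | β) = f c(α₁,…,α_a | β) + df ∧ c(α₁,…,α_{a-1} | α_a, β)`. -/
structure IsStackForm (c : PreStackForm E F A) : Prop where
  left : ∀ a i b β v, ∃ m : Sec E X F A [⋀^Fin a]→ₗ[ℝ] Fun E X, ∀ α, c a i α β b v = m α
  middle : ∀ a i b α v, ∃ m : MultilinearMap (Fun E X) (fun _ : Fin i => Sec E X F A) (Fun E X),
    ∀ β, c a i α β b v = m β
  symm : ∀ a i α β (τ : Equiv.Perm (Fin i)), c a i α (β ∘ τ) = c a i α β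
  right : ∀ a i α β, IsDiffForm (c a i α β)
  symbol : ∀ a i (α : Fin a → Sec E X F A) (x : Sec E X F A) (β : Fin i → Sec E X F A)
    (f : Fun E X) b v,
    c (a + 1) i (Fin.snoc (α := fun _ => Sec E X F A) α (f • x)) β b v =
      f * c (a + 1) i (Fin.snoc (α := fun _ => Sec E X F A) α x) β b v +
        dWedge f (c a (i + 1) α (Fin.cons x β)) b v

variable (E F A) in
/-- `p`-forms of cohomological degree `q` on the quotient stack `[X/A]`: the operator
`c(α₁,…,α_a | β₁,…,β_i)` with values in `b`-forms has form degree `b + i` and cohomological degree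
`a + i`. -/
structure StackForm (p : ℕ) (q : ℤ) where
  /-- The family of operators. -/
  op : PreStackForm E F A
  isStackForm : IsStackForm op
  support : ∀ a i b α β v, ¬ (b + i = p ∧ ((a + i : ℕ) : ℤ) = q) → op a i α β b v = 0

/-- The de Rham differential on `[X/A]`. -/
def stackD (c : PreStackForm E F A) : PreStackForm E F A
  | a, 0, α, β => (-1 : ℤ) ^ a • extD (c a 0 α β)
  | a, i + 1, α, β => (-1 : ℤ) ^ a • extD (c a (i + 1) α β) -
      ∑ s : Fin (i + 1), c (a + 1) i (Fin.cons (β s) α) (s.removeNth β)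

variable [FiniteDimensional ℝ F] [ContMDiffVectorBundle ∞ F A 𝓘(ℝ, E)]

/-- The Chevalley-Eilenberg part of the internal differential. -/
def stackCE (L : LieAlgebroid E F A) (c : PreStackForm E F A) : PreStackForm E F A
  | 0, _, _, _ => 0
  | a + 1, i, α, β => ∑ t : Fin (a + 1), (-1 : ℤ) ^ (t : ℕ) •
      (lieD (onSec L.anchor (α t)) (c a i (t.removeNth α) β) -
        ∑ s : Fin i, c a i (t.removeNth α) (Function.update β s (L.bracket (α t) (β s))) -
        ∑ s ∈ Finset.Ioi t,
          c a i (t.removeNth (Function.update α s (L.bracket (α t) (α s)))) β)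

/-- The contraction part of the internal differential. -/
def stackContract (L : LieAlgebroid E F A) (c : PreStackForm E F A) : PreStackForm E F A
  | _, 0, _, _ => 0
  | a, i + 1, α, β => (-1 : ℤ) ^ a •
      ∑ s : Fin (i + 1), contract (onSec L.anchor (β s)) (c a i α (s.removeNth β))

/-- The internal differential `δ` on `[X/A]`: the Lie derivative along the homological vector field of
`A[1]`. It anticommutes with `stackD`. -/
def stackDelta (L : LieAlgebroid E F A) (c : PreStackForm E F A) : PreStackForm E F A :=
  stackCE L c + stackContract L c

/-- A closed `2`-form of degree `n` on `[X/A]`: a sequence `ω_k ∈ Ω^{2+k,n-k}` with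
`d ω_{k-1} + δ ω_k = 0`, where `ω_{-1} = 0`. -/
structure ClosedTwoForm (L : LieAlgebroid E F A) (n : ℤ) where
  /-- The sequence of forms. -/
  form : ∀ k : ℕ, StackForm E F A (2 + k) (n - k)
  closed_zero : stackDelta L (form 0).op = 0
  closed_succ : ∀ k, stackD (form k).op + stackDelta L (form (k + 1)).op = 0

/-! ### Tangent complexes

Complexes of vector bundles on `X` are represented by the complexes of `C^∞(X)`-modules of their smooth
sections, and a section of the dual of a bundle `B` is a `C^∞(X)`-linear map from sections of `B` to
functions. The tangent complex of `[X/A]` is pulled back to the atlas `X`. -/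

/-- `𝕋_{[X/A]}`: the complex `A → TX` in degrees `-1, 0`. -/
def tangent (L : LieAlgebroid E F A) : CochainComplex (ModuleCat.{u} (Fun E X)) ℤ :=
  HomologicalComplex.double (i₀ := -1) (i₁ := 0) (ModuleCat.ofHom (onSec L.anchor)) (by simp)

/-- `𝕋^∨_{[X/A]}[1]`: the complex `T^*X → A^*` in degrees `-1, 0`, with the transpose of the anchor
as differential. -/
def cotangentShift (L : LieAlgebroid E F A) : CochainComplex (ModuleCat.{u} (Fun E X)) ℤ :=
  HomologicalComplex.double (i₀ := -1) (i₁ := 0)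
    (ModuleCat.ofHom (Module.Dual.transpose (R := Fun E X) (onSec L.anchor))) (by simp)


theorem update_one {T : Type u} (x y : T) : Function.update ![x] 0 y = ![y] := by
  ext i; fin_cases i; rfl

theorem update_two_zero {T : Type u} (x y z : T) : Function.update ![x, y] 0 z = ![z, y] := by
  ext i; fin_cases i <;> rfl

theorem update_two_one {T : Type u} (x y z : T) : Function.update ![x, y] 1 z = ![x, z] := by
  ext i; fin_cases i <;> rfl

/-- The pairing `(a, v) ↦ c(| a)(v)` of `A` and `TX` given by a form on `[X/A]`. -/
def symbolPairing {c : PreStackForm E F A} (hc : IsStackForm c) :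
    Sec E X F A →ₗ[Fun E X] Module.Dual (Fun E X) (VF E X) :=
  LinearMap.mk₂ (Fun E X) (fun a v => c 0 1 ![] ![a] 1 ![v])
    (fun a a' v => by
      obtain ⟨m, hm⟩ := hc.middle 0 1 1 ![] ![v]
      simp only [hm]
      have h' := m.map_update_add ![a] 0 a a'
      simp only [update_one] at h'
      exact h')
    (fun f a v => by
      obtain ⟨m, hm⟩ := hc.middle 0 1 1 ![] ![v]
      simp only [hm]
      have h' := m.map_update_smul ![a] 0 f a
      simp only [update_one] at h'
      exact h')
    (fun a v v' => by
      obtain ⟨m, hm⟩ := hc.right 0 1 ![] ![a] 1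
      simp only [hm]
      have h' := m.map_update_add ![v] 0 v v'
      simp only [update_one] at h'
      exact h')
    (fun f a v => by
      obtain ⟨m, hm⟩ := hc.right 0 1 ![] ![a] 1
      simp only [hm]
      have h' := m.map_update_smul ![v] 0 f v
      simp only [update_one] at h'
      exact h')

/-- Contraction `v ↦ η(v, -)` with the degree `2` part of a form on `X`. -/
def formPairing {η : PreForm E X} (h : IsDiffForm η) :
    VF E X →ₗ[Fun E X] Module.Dual (Fun E X) (VF E X) :=
  LinearMap.mk₂ (Fun E X) (fun v w => η 2 ![v, w])
    (fun v v' w => by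
      obtain ⟨m, hm⟩ := h 2
      simp only [hm]
      have h' := m.map_update_add ![v, w] 0 v v'
      simp only [update_two_zero] at h'
      exact h')
    (fun f v w => by
      obtain ⟨m, hm⟩ := h 2
      simp only [hm]
      have h' := m.map_update_smul ![v, w] 0 f v
      simp only [update_two_zero] at h'
      exact h')
    (fun v w w' => by
      obtain ⟨m, hm⟩ := h 2
      simp only [hm]
      have h' := m.map_update_add ![v, w] 1 w w'
      simp only [update_two_one] at h'
      exact h')
    (fun f v w => by
      obtain ⟨m, hm⟩ := h 2
      simp only [hm]
      have h' := m.map_update_smul ![v, w] 1 f w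
      simp only [update_two_one] at h'
      exact h')

theorem ClosedTwoForm.symbol_anchor_skew {L : LieAlgebroid E F A} (Ω : ClosedTwoForm L 1)
    (a b : Sec E X F A) :
    symbolPairing (Ω.form 0).isStackForm a (onSec L.anchor b) =
      -symbolPairing (Ω.form 0).isStackForm b (onSec L.anchor a) := by
  have h := congrFun (congrFun (congrFun (congrFun (congrFun (congrFun Ω.closed_zero 0) 2) ![])
    ![a, b]) 0) ![]
  have e0 : Fin.removeNth (α := fun _ => Sec E X F A) 0 ![a, b] = ![b] := by
    ext i; fin_cases i; rfl
  have e1 : Fin.removeNth (α := fun _ => Sec E X F A) 1 ![a, b] = ![a] := by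
    ext i; fin_cases i; rfl
  simp only [stackDelta, stackCE, stackContract, Pi.add_apply, Pi.zero_apply, pow_zero, one_smul,
    zero_add] at h
  rw [Fin.sum_univ_two, e0, e1] at h
  rw [add_comm] at h
  exact eq_neg_of_add_eq_zero_left h

/-- The map `Ω₀^♭ : 𝕋_{[X/A]} → 𝕋^∨_{[X/A]}[1]` given by contraction with `Ω₀`: it sends `a` to
`Ω₀(a, -)` in degree `-1` and `v` to `Ω₀(v, -) = -Ω₀(-, v)` in degree `0`. -/
def ClosedTwoForm.flat {L : LieAlgebroid E F A} (Ω : ClosedTwoForm L 1) :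
    tangent L ⟶ cotangentShift L :=
  HomologicalComplex.mkHomFromDouble _ (by simp)
    (ModuleCat.ofHom (symbolPairing (Ω.form 0).isStackForm) ≫
      (HomologicalComplex.doubleXIso₀ _ _).inv)
    (ModuleCat.ofHom (-(symbolPairing (Ω.form 0).isStackForm).flip) ≫
      (HomologicalComplex.doubleXIso₁ _ _ (by simp)).inv)
    (by
      have h : ModuleCat.ofHom (symbolPairing (Ω.form 0).isStackForm) ≫
          ModuleCat.ofHom (Module.Dual.transpose (R := Fun E X) (onSec L.anchor)) =
          ModuleCat.ofHom (onSec L.anchor) ≫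
            ModuleCat.ofHom (-(symbolPairing (Ω.form 0).isStackForm).flip) := by
        refine ModuleCat.hom_ext (LinearMap.ext fun a => LinearMap.ext fun b => ?_)
        exact Ω.symbol_anchor_skew a b
      simp only [cotangentShift, HomologicalComplex.double_d _ _ (show (-1 : ℤ) ≠ 0 by simp),
        Category.assoc, Iso.inv_hom_id_assoc]
      rw [reassoc_of% h])
    (fun k _ => by
      unfold cotangentShift
      rw [HomologicalComplex.double_d_eq_zero₀ _ _ _ _ (by simp),
        Limits.comp_zero])

/-- A `1`-shifted symplectic structure on `[X/A]`: a closed `2`-form of degree `1` whose leading term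
is non-degenerate. -/
structure ShiftedSymplectic (L : LieAlgebroid E F A) extends ClosedTwoForm L 1 where
  nondegenerate : QuasiIso toClosedTwoForm.flat

/-! ### Lagrangian structures on the quotient map `X → [X/A]` -/

variable (E X) in
/-- `p`-forms of cohomological degree `q` on the manifold `X`; they vanish for `q ≠ 0`. -/
structure ManifoldForm (p : ℕ) (q : ℤ) where
  /-- The underlying form. -/
  form : PreForm E X
  isDiffForm : IsDiffForm form
  support : ∀ b v, ¬ (b = p ∧ q = 0) → form b v = 0

variable (E X) in
/-- The zero form. -/
instance (p : ℕ) (q : ℤ) : Zero (ManifoldForm E X p q) :=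
  ⟨⟨0, fun _ => ⟨0, fun _ => rfl⟩, fun _ _ _ => rfl⟩⟩

/-- Pullback of forms along the quotient map `X → [X/A]`. -/
def pullback (c : PreStackForm E F A) : PreForm E X := c 0 0 ![] ![]

/-- An isotropic structure on the quotient map `q : X → [X/A]`: a sequence
`γ_k ∈ Ω_X^{2+k,n-1-k}` with `(d + δ) γ = q^* Ω`; on the manifold `X` the internal differential `δ`
is zero. -/
structure Isotropic {L : LieAlgebroid E F A} {n : ℤ} (Ω : ClosedTwoForm L n) where
  /-- The sequence of forms. -/
  form : ∀ k : ℕ, ManifoldForm E X (2 + k) (n - 1 - k)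
  eq_zero : 0 = pullback (Ω.form 0).op
  eq_succ : ∀ k, extD (form k).form = pullback (Ω.form (k + 1)).op

/-- The relative tangent complex `𝕋_{X/[X/A]}`, the fibre of `TX → q^*𝕋_{[X/A]}`: the complex
`TX ⊕ A → TX`, `(v, a) ↦ v - ρ(a)`, in degrees `0, 1`. -/
def relTangent (L : LieAlgebroid E F A) : CochainComplex (ModuleCat.{u} (Fun E X)) ℤ :=
  HomologicalComplex.double (i₀ := 0) (i₁ := 1)
    (ModuleCat.ofHom (LinearMap.fst (Fun E X) (VF E X) (Sec E X F A) -
      (onSec L.anchor).comp (LinearMap.snd (Fun E X) (VF E X) (Sec E X F A)))) (by simp)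

variable (E X) in
/-- `𝕋^∨_X`: the cotangent bundle of `X` in degree `0`. -/
def manifoldCotangent : CochainComplex (ModuleCat.{u} (Fun E X)) ℤ :=
  (HomologicalComplex.single _ _ 0).obj (ModuleCat.of _ (Module.Dual (Fun E X) (VF E X)))

/-- The degree `0` part `TX ⊕ A → T^*X`, `(v, a) ↦ Ω₀(a, -) - γ₀(v, -)`, of the map `γ^♭`. The first
term comes from the canonical null-homotopy `(v, a) ↦ a` of `𝕋_{X/[X/A]} → TX → q^*𝕋_{[X/A]}` followed
by `Ω₀^♭`, the second one from the null-homotopy given by `γ₀`. -/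
def Isotropic.flatZero {L : LieAlgebroid E F A} {Ω : ClosedTwoForm L 1} (γ : Isotropic Ω) :
    VF E X × Sec E X F A →ₗ[Fun E X] Module.Dual (Fun E X) (VF E X) :=
  (symbolPairing (Ω.form 0).isStackForm).comp (LinearMap.snd _ _ _) -
    (formPairing (γ.form 0).isDiffForm).comp (LinearMap.fst _ _ _)

/-- The map `γ^♭ : 𝕋_{X/[X/A]} → 𝕋^∨_X`. -/
def Isotropic.flat {L : LieAlgebroid E F A} {Ω : ClosedTwoForm L 1} (γ : Isotropic Ω) :
    relTangent L ⟶ manifoldCotangent E X :=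
  HomologicalComplex.mkHomFromDouble _ (by simp)
    (ModuleCat.ofHom γ.flatZero ≫ (HomologicalComplex.singleObjXSelf _ _ _).inv) 0
    (by
      simp only [manifoldCotangent, HomologicalComplex.single_obj_d, Limits.comp_zero]
      exact Limits.comp_zero.symm) (by simp)

/-- A Lagrangian structure on `q : X → [X/A]`: an isotropic structure for which `γ^♭` is a
quasi-isomorphism. -/
structure Lagrangian {L : LieAlgebroid E F A} (Ω : ShiftedSymplectic L) extends
    Isotropic Ω.toClosedTwoForm where
  quasiIso : QuasiIso toIsotropic.flat

end Algebroid

/-! ### The canonical form -/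

section Canonical

variable (E : Type u) [NormedAddCommGroup E] [NormedSpace ℝ E] [FiniteDimensional ℝ E]
  (X : Type u) [TopologicalSpace X] [ChartedSpace E X] [IsManifold 𝓘(ℝ, E) ∞ X]

/-- The canonical form on `[X/T^*X]`: the operator `d : Γ(T^*X) → Ω²(X)` with symbol the identity
`T^*X → T^*X`. -/
def canonicalOp : PreStackForm (X := X) E (E →L[ℝ] ℝ) (Cotangent E X)
  | 1, 0, α, _ => extD (toPreForm (α 0))
  | 0, 1, _, β => toPreForm (β 0)
  | _, _, _, _ => 0

end Canonical

end PoissonStack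

end

set_option linter.unusedSectionVars false

noncomputable section

namespace PoissonStack

/-! ### Derivations, the pairing and differentials of functions -/

section CalculusLemmas

variable {E : Type u} [NormedAddCommGroup E] [NormedSpace ℝ E] [FiniteDimensional ℝ E]
  {X : Type u} [TopologicalSpace X] [ChartedSpace E X] [IsManifold 𝓘(ℝ, E) ∞ X]

/-! The form `ω₀` has just two nonzero components, the operator `d` and its symbol `id`, so each
identity reduces to low-degree Cartan calculus. In `dω₀ = 0` the exterior derivative of the symbol
cancels against the operator, and the rest is `d² = 0`. The equation `δω₀ = 0` has three components
(`stackDelta_canonicalOp`): skewness of `P`, the formula `[α,β] = L_{Pα}β - ι_{Pβ}dα`, and its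
differential `d[α,β] = L_{Pα}dβ - L_{Pβ}dα`. No higher corrections are needed. In its two degrees
`ω₀^♭` is, up to sign, the duality between `T^*X` and `TX`, hence an isomorphism of complexes.

The pullback of `ω` to `X` is its component without algebroid arguments, which is zero, so `γ = 0`
is isotropic. The differential `(v, α) ↦ v - Pα` of the relative tangent complex is a split
surjection whose kernel is the graph of `P`. The projection `(v, α) ↦ α` maps this graph
isomorphically to `T^*X`, so `γ^♭` is a homotopy equivalence (`quasiIso_double_single`).

Two facts support this. First, smooth 1-forms and vector fields are each other's `C^∞(X)`-duals
(`pairing_bijective`, `pairing_flip_bijective`), by cutting off coordinate frames with bump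
functions (`exists_local_frame`). Second, the bracket is a Lie algebroid bracket: the defects of
anchor compatibility and of the Jacobi identity are tensorial, so exact forms suffice
(`eq_zero_of_dFun`). There `[df, dg] = d{f, g}`, and both reduce to the Jacobi identity of the
Poisson bracket. -/

theorem act_apply (v : VF E X) (f : Fun E X) (x : X) :
    act v f x = mvfderiv 𝓘(ℝ, E) f x (v x) := rfl

theorem act_add (v : VF E X) (f g : Fun E X) : act v (f + g) = act v f + act v g := by
  ext x
  have h := mvfderiv_add (I := 𝓘(ℝ, E)) (f.mdifferentiableAt (x := x)) (g.mdifferentiableAt (x := x))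
  exact congrArg (fun T => T (v x)) h

theorem act_mul (v : VF E X) (f g : Fun E X) : act v (f * g) = f * act v g + g * act v f := by
  ext x
  have h := mvfderiv_mul (I := 𝓘(ℝ, E)) (f.mdifferentiableAt (x := x)) (g.mdifferentiableAt (x := x))
  exact congrArg (fun T => T (v x)) h

theorem act_algebraMap (v : VF E X) (c : ℝ) : act v (algebraMap ℝ (Fun E X) c) = 0 := by
  ext x
  have h := mvfderiv_const (I := 𝓘(ℝ, E)) (M := X) c (x := x)
  exact congrArg (fun T => T (v x)) h

theorem act_smul_real (v : VF E X) (c : ℝ) (f : Fun E X) : act v (c • f) = c • act v f := by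
  rw [Algebra.smul_def, Algebra.smul_def, act_mul, act_algebraMap, mul_zero, add_zero]

/-- The derivative along `v`, as an additive map. -/
def actHom (v : VF E X) : Fun E X →+ Fun E X := AddMonoidHom.mk' (act v) (act_add v)

theorem act_zero (v : VF E X) : act v 0 = 0 := (actHom v).map_zero

theorem act_neg (v : VF E X) (f : Fun E X) : act v (-f) = -act v f := (actHom v).map_neg f

theorem act_sub (v : VF E X) (f g : Fun E X) : act v (f - g) = act v f - act v g :=
  (actHom v).map_sub f g

theorem add_act (v w : VF E X) (f : Fun E X) : act (v + w) f = act v f + act w f := by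
  ext x
  exact map_add (mvfderiv 𝓘(ℝ, E) f x) (v x) (w x)

theorem smul_act (g : Fun E X) (v : VF E X) (f : Fun E X) : act (g • v) f = g * act v f := by
  ext x
  exact map_smul (mvfderiv 𝓘(ℝ, E) f x) (g x) (v x)

theorem pair_add (α : CoSec E X) (v w : VF E X) : pair α (v + w) = pair α v + pair α w := by
  ext x
  exact map_add (α x) (v x) (w x)

theorem pair_smul (α : CoSec E X) (f : Fun E X) (v : VF E X) : pair α (f • v) = f * pair α v := by
  ext x
  exact map_smul (α x) (f x) (v x)

theorem add_pair (α β : CoSec E X) (v : VF E X) : pair (α + β) v = pair α v + pair β v := rfl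

theorem smul_pair (f : Fun E X) (α : CoSec E X) (v : VF E X) : pair (f • α) v = f * pair α v := rfl

variable (E X) in
/-- The pairing of `1`-forms and vector fields, as a bilinear map over the smooth functions. -/
def pairing : CoSec E X →ₗ[Fun E X] Module.Dual (Fun E X) (VF E X) :=
  LinearMap.mk₂ (Fun E X) pair add_pair smul_pair pair_add (fun f α v => pair_smul α f v)

theorem pairing_apply (α : CoSec E X) (v : VF E X) : pairing E X α v = pair α v := rfl

theorem pair_neg (α : CoSec E X) (v : VF E X) : pair α (-v) = -pair α v :=
  (pairing E X α).map_neg v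

theorem smul_real_pair (c : ℝ) (α : CoSec E X) (v : VF E X) : pair (c • α) v = c • pair α v := rfl

theorem VF.mdifferentiableAt (v : VF E X) (x : X) :
    MDifferentiableAt 𝓘(ℝ, E) 𝓘(ℝ, E).tangent
      (fun y => (⟨y, v y⟩ : TangentBundle 𝓘(ℝ, E) X)) x :=
  v.contMDiff.mdifferentiableAt (by simp)

/-! ### The Lie bracket of vector fields as a commutator of derivations -/

section LieBracket

theorem lie_apply (v w : VF E X) (x : X) :
    lie v w x = VectorField.mlieBracket 𝓘(ℝ, E) v w x := rfl

theorem isManifold_minSmoothness (n : ℕ) : IsManifold 𝓘(ℝ, E) (minSmoothness ℝ n) X :=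
  IsManifold.of_le (n := ∞) (by
    rw [minSmoothness_of_isRCLikeNormedField]
    exact WithTop.coe_le_coe.2 (le_top : (n : ℕ∞) ≤ ⊤))

theorem lie_swap (v w : VF E X) : lie v w = -lie w v := by
  ext x
  exact VectorField.mlieBracket_swap_apply

theorem lie_add (v w w' : VF E X) : lie v (w + w') = lie v w + lie v w' := by
  have : CompleteSpace E := FiniteDimensional.complete ℝ E
  have : IsManifold 𝓘(ℝ, E) 2 X := IsManifold.of_le (n := ∞)
    (WithTop.coe_le_coe.2 (le_top : (2 : ℕ∞) ≤ ⊤))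
  ext x
  exact VectorField.mlieBracket_add_right (w.mdifferentiableAt x) (w'.mdifferentiableAt x)

theorem lie_smul (v : VF E X) (f : Fun E X) (w : VF E X) :
    lie v (f • w) = act v f • w + f • lie v w := by
  have : CompleteSpace E := FiniteDimensional.complete ℝ E
  have : IsManifold 𝓘(ℝ, E) 2 X := IsManifold.of_le (n := ∞)
    (WithTop.coe_le_coe.2 (le_top : (2 : ℕ∞) ≤ ⊤))
  ext x
  exact VectorField.mlieBracket_smul_right f.mdifferentiableAt (w.mdifferentiableAt x)

theorem add_lie (v v' w : VF E X) : lie (v + v') w = lie v w + lie v' w := by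
  rw [lie_swap, lie_add, lie_swap w v, lie_swap w v']
  abel

theorem smul_lie (f : Fun E X) (v w : VF E X) :
    lie (f • v) w = -act w f • v + f • lie v w := by
  rw [lie_swap, lie_smul, lie_swap w v, smul_neg, neg_add, neg_neg, neg_smul]

theorem lie_jacobi (u v w : VF E X) :
    lie u (lie v w) = lie (lie u v) w + lie v (lie u w) := by
  have : CompleteSpace E := FiniteDimensional.complete ℝ E
  have : IsManifold 𝓘(ℝ, E) (minSmoothness ℝ 3) X := isManifold_minSmoothness 3
  ext x
  have h (v : VF E X) : ContMDiffAt 𝓘(ℝ, E) 𝓘(ℝ, E).tangent (minSmoothness ℝ 2)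
      (fun y => (⟨y, v y⟩ : TangentBundle 𝓘(ℝ, E) X)) x :=
    (v.contMDiff x).of_le (by
      rw [minSmoothness_of_isRCLikeNormedField]
      exact WithTop.coe_le_coe.2 (le_top : (2 : ℕ∞) ≤ ⊤))
  exact VectorField.leibniz_identity_mlieBracket_apply (h u) (h v) (h w)

/-- The representative of a vector field in the chart at `x`. -/
def inChart (x : X) (v : VF E X) : E → E :=
  VectorField.mpullbackWithin 𝓘(ℝ, E) 𝓘(ℝ, E) (extChartAt 𝓘(ℝ, E) x).symm v
    (Set.range 𝓘(ℝ, E))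

/-- Chain rule: the pullback of `v` applies the inverse of the derivative of the inverse chart,
which the derivative of `f ∘ φ⁻¹` undoes. It is stated on the whole chart target so that it can be
differentiated again. -/
theorem fderiv_inChart (x : X) (f : X → ℝ) (hf : ContMDiff 𝓘(ℝ, E) 𝓘(ℝ, ℝ) ∞ f) (v : VF E X) {z : E}
    (hz : z ∈ (extChartAt 𝓘(ℝ, E) x).target) :
    fderiv ℝ (f ∘ (extChartAt 𝓘(ℝ, E) x).symm) z (inChart x v z) =
      mvfderiv 𝓘(ℝ, E) f ((extChartAt 𝓘(ℝ, E) x).symm z) (v ((extChartAt 𝓘(ℝ, E) x).symm z)) := by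
  have : IsManifold 𝓘(ℝ, E) 1 X := IsManifold.of_le (n := ∞)
    (WithTop.coe_le_coe.2 (le_top : (1 : ℕ∞) ≤ ⊤))
  have hinv := isInvertible_mfderivWithin_extChartAt_symm (I := 𝓘(ℝ, E)) (x := x) hz
  have hd : MDifferentiableAt 𝓘(ℝ, E) 𝓘(ℝ, E) (extChartAt 𝓘(ℝ, E) x).symm z := by
    have := mdifferentiableWithinAt_extChartAt_symm (I := 𝓘(ℝ, E)) (x := x) hz
    rwa [modelWithCornersSelf_coe, Set.range_id, mdifferentiableWithinAt_univ] at this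
  have hfd : MDifferentiableAt 𝓘(ℝ, E) 𝓘(ℝ, ℝ) f ((extChartAt 𝓘(ℝ, E) x).symm z) :=
    hf.mdifferentiableAt (by simp)
  have h := mfderiv_comp_of_eq hfd hd rfl
  rw [mfderiv_eq_fderiv] at h
  rw [h]
  simp only [modelWithCornersSelf_coe, Set.range_id, mfderivWithin_univ] at hinv
  simp only [inChart, VectorField.mpullbackWithin_apply, modelWithCornersSelf_coe, Set.range_id,
    mfderivWithin_univ]
  change mfderiv 𝓘(ℝ, E) 𝓘(ℝ, ℝ) f _ (mfderiv 𝓘(ℝ, E) 𝓘(ℝ, E) _ z _) = _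
  rw [hinv.self_apply_inverse]
  rfl

/-- The manifold bracket is the pullback of the bracket in a chart, and in a vector space the
commutator formula is the symmetry of second derivatives. All later Cartan identities rest on this
one. -/
theorem act_lie (v w : VF E X) (f : Fun E X) :
    act (lie v w) f = act v (act w f) - act w (act v f) := by
  have : CompleteSpace E := FiniteDimensional.complete ℝ E
  have : IsManifold 𝓘(ℝ, E) 2 X := IsManifold.of_le (n := ∞)
    (WithTop.coe_le_coe.2 (le_top : (2 : ℕ∞) ≤ ⊤))
  have : IsManifold 𝓘(ℝ, E) 1 X := IsManifold.of_le (n := ∞)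
    (WithTop.coe_le_coe.2 (le_top : (1 : ℕ∞) ≤ ⊤))
  ext x
  set φ := extChartAt 𝓘(ℝ, E) x with hφ
  have hx : φ.symm (φ x) = x := extChartAt_to_inv x
  have hnhds : φ.target ∈ nhds (φ x) := extChartAt_target_mem_nhds x
  have hA := isInvertible_mfderiv_extChartAt (I := 𝓘(ℝ, E)) (mem_extChartAt_source (I := 𝓘(ℝ, E)) x)
  have hf' : ContDiffAt ℝ ∞ (f ∘ φ.symm) (φ x) := by
    have h1 : ContMDiffAt 𝓘(ℝ, E) 𝓘(ℝ, E) ∞ φ.symm (φ x) :=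
      (contMDiffOn_extChartAt_symm x).contMDiffAt hnhds
    exact ((f.contMDiff _).comp _ h1).contDiffAt
  have hdiff (u : VF E X) : DifferentiableAt ℝ (inChart x u) (φ x) := by
    have h := (u.mdifferentiableAt x).mdifferentiableWithinAt
      (s := Set.univ) |>.differentiableWithinAt_mpullbackWithin_vectorField
    have h' : DifferentiableWithinAt ℝ (inChart x u) (Set.univ ∩ Set.range 𝓘(ℝ, E)) (φ x) := h
    rwa [Set.univ_inter, modelWithCornersSelf_coe, Set.range_id,
      differentiableWithinAt_univ] at h'
  -- The inner derivative agrees with `act u f` read in the chart near the base point, so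
  -- `fderiv_inChart` applies a second time.
  have hact (u u' : VF E X) :
      fderiv ℝ (fun z => fderiv ℝ (f ∘ φ.symm) z (inChart x u z)) (φ x) (inChart x u' (φ x)) =
        act u' (act u f) x := by
    have h1 : (fun z => fderiv ℝ (f ∘ φ.symm) z (inChart x u z)) =ᶠ[nhds (φ x)]
        act u f ∘ φ.symm := by
      filter_upwards [hnhds] with z hz
      exact fderiv_inChart x f f.contMDiff u hz
    rw [h1.fderiv_eq, fderiv_inChart x _ (act u f).contMDiff u' (mem_extChartAt_target x)]
    exact congrArg (act u' (act u f)) hx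
  have hlie : mvfderiv 𝓘(ℝ, E) f x (lie v w x) =
      fderiv ℝ (f ∘ φ.symm) (φ x)
        (VectorField.lieBracket ℝ (inChart x v) (inChart x w) (φ x)) := by
    have h1 : (f : X → ℝ) =ᶠ[nhds x] (f ∘ φ.symm) ∘ φ := by
      filter_upwards [extChartAt_source_mem_nhds (I := 𝓘(ℝ, E)) x] with y hy
      exact congrArg f (φ.left_inv hy).symm
    have h2 : mfderiv 𝓘(ℝ, E) 𝓘(ℝ, ℝ) f x = (fderiv ℝ (f ∘ φ.symm) (φ x)).comp
        (mfderiv 𝓘(ℝ, E) 𝓘(ℝ, E) φ x) := by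
      rw [h1.mfderiv_eq, ← mfderiv_eq_fderiv]
      exact mfderiv_comp x (hf'.differentiableAt (by simp)).mdifferentiableAt
        (mdifferentiableAt_extChartAt (mem_chart_source E x))
    let b : E := VectorField.lieBracket ℝ (inChart x v) (inChart x w) (φ x)
    have h3 : lie v w x = (mfderiv 𝓘(ℝ, E) 𝓘(ℝ, E) φ x).inverse b := by
      rw [lie_apply, ← VectorField.mlieBracketWithin_univ, VectorField.mlieBracketWithin_apply]
      congr 1
      rw [Set.preimage_univ, Set.univ_inter]
      simp only [b, ← VectorField.lieBracketWithin_univ]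
      congr 1
      exact Set.range_id
    change mfderiv 𝓘(ℝ, E) 𝓘(ℝ, ℝ) f x (lie v w x) = _
    rw [h2, h3]
    exact congrArg (fderiv ℝ (f ∘ φ.symm) (φ x)) (hA.self_apply_inverse _)
  rw [act_apply, hlie, VectorField.fderiv_apply_lieBracket hf' (by
    rw [minSmoothness_of_isRCLikeNormedField]
    exact WithTop.coe_le_coe.2 (le_top : (2 : ℕ∞) ≤ ⊤)) (hdiff w) (hdiff v), hact, hact]
  rfl

end LieBracket

/-- Smoothness in the hom bundle is smoothness in trivializations. The target is the trivial bundle,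
so the coordinate expression is that of `mfderiv` in tangent coordinates. -/
theorem contMDiff_mvfderiv (f : Fun E X) :
    ContMDiff 𝓘(ℝ, E) (𝓘(ℝ, E).prod 𝓘(ℝ, E →L[ℝ] ℝ)) ∞
      (fun x => TotalSpace.mk' (E →L[ℝ] ℝ) (E := Cotangent E X) x (mvfderiv 𝓘(ℝ, E) f x)) := by
  intro x
  rw [contMDiffAt_hom_bundle]
  refine ⟨contMDiffAt_id, ?_⟩
  have h := (f.contMDiff x).mfderiv_const (m := ∞) (by rfl)
  refine h.congr_of_eventuallyEq (Filter.Eventually.of_forall fun y => ?_)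
  simp only [inTangentCoordinates, ContinuousLinearMap.inCoordinates]
  ext e
  simp
  rfl

/-- The differential of a function, as a section of the cotangent bundle. -/
def dFun (f : Fun E X) : CoSec E X := ⟨fun x => mvfderiv 𝓘(ℝ, E) f x, contMDiff_mvfderiv f⟩

theorem pair_dFun (f : Fun E X) (v : VF E X) : pair (dFun f) v = act v f := rfl

end CalculusLemmas

/-! ### Cut-off coordinate frames and the duality of forms and vector fields -/

section LocalCoframe

variable {E : Type u} [NormedAddCommGroup E] [NormedSpace ℝ E] [FiniteDimensional ℝ E]
  {X : Type u} [TopologicalSpace X] [ChartedSpace E X] [IsManifold 𝓘(ℝ, E) ∞ X] [T2Space X]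

/-- Around every point there are globally defined functions `f i` and vector fields `e i` such that
the `df i` and the `e i` form dual bases, up to a function `ψ` that is `1` at the point. -/
theorem exists_local_frame (x : X) :
    ∃ (ψ : Fun E X) (n : ℕ) (f : Fin n → Fun E X) (e : Fin n → VF E X), ψ x = 1 ∧
      ∀ (y : X) (w : TangentSpace 𝓘(ℝ, E) y),
        ψ y • w = ∑ i, mvfderiv 𝓘(ℝ, E) (f i) y w • e i y := by
  have : IsManifold 𝓘(ℝ, E) 1 X := IsManifold.of_le (n := ∞)
    (WithTop.coe_le_coe.2 (le_top : (1 : ℕ∞) ≤ ⊤))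
  let b := Module.finBasis ℝ E
  let c (i) : E →L[ℝ] ℝ := LinearMap.toContinuousLinearMap (b.coord i)
  let T := trivializationAt E (TangentSpace 𝓘(ℝ, E) : X → Type u) x
  -- Two nested cut-offs: `χ` makes the coordinate functions global, and `ψ`, supported where `χ` is
  -- locally 1, makes the frame global. Where `ψ ≠ 0`, differentiating `χ` thus contributes nothing.
  obtain ⟨χ, -⟩ := (SmoothBumpFunction.nhds_basis_tsupport (I := 𝓘(ℝ, E)) x).ex_mem
  have hU : {y | χ =ᶠ[nhds y] 1} ∩ (chartAt E x).source ∈ nhds x :=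
    Filter.inter_mem (eventually_eventually_nhds.2 χ.eventuallyEq_one)
      (chart_source_mem_nhds E x)
  obtain ⟨ψ, -, hψ⟩ := (SmoothBumpFunction.nhds_basis_tsupport (I := 𝓘(ℝ, E)) x).mem_iff.1 hU
  have hf (i) : ContMDiff 𝓘(ℝ, E) 𝓘(ℝ, ℝ) ∞ (fun y => χ y • c i (extChartAt 𝓘(ℝ, E) x y)) := by
    apply χ.contMDiff_smul
    exact (c i).contMDiff.comp_contMDiffOn (contMDiffOn_extChartAt (I := 𝓘(ℝ, E)) (x := x))
  have he (i) : ContMDiff 𝓘(ℝ, E) (𝓘(ℝ, E).prod 𝓘(ℝ, E)) ∞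
      (fun y => TotalSpace.mk' E (E := (TangentSpace 𝓘(ℝ, E) : X → Type u)) y
        (ψ y • T.localFrame b i y)) := by
    refine ContMDiffOn.smul_section_of_tsupport (u := T.baseSet) ψ.contMDiff.contMDiffOn
      T.open_baseSet (fun y hy => (hψ hy).2)
      (T.contMDiffOn_localFrame_baseSet ∞ b i)
  refine ⟨⟨ψ, ψ.contMDiff⟩, _, fun i => ⟨_, hf i⟩, fun i => ⟨_, he i⟩, ψ.eq_one, fun y w => ?_⟩
  change ψ y • w = ∑ i, mvfderiv 𝓘(ℝ, E) (fun y => χ y • c i (extChartAt 𝓘(ℝ, E) x y)) y w •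
    (ψ y • T.localFrame b i y)
  by_cases hy : ψ y = 0
  · simp [hy]
  · obtain ⟨h1, h2⟩ := hψ (subset_tsupport _ hy)
    have hT : y ∈ T.baseSet := h2
    have hd (i) : mvfderiv 𝓘(ℝ, E) (fun y => χ y • c i (extChartAt 𝓘(ℝ, E) x y)) y w =
        b.coord i (T.continuousLinearMapAt ℝ y w) := by
      have h3 : (fun y => χ y • c i (extChartAt 𝓘(ℝ, E) x y)) =ᶠ[nhds y]
          (c i) ∘ extChartAt 𝓘(ℝ, E) x := by
        filter_upwards [h1] with z hz
        simp [hz]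
      have h4 : mfderiv 𝓘(ℝ, E) 𝓘(ℝ, ℝ) (c i ∘ extChartAt 𝓘(ℝ, E) x) y =
          (c i).comp (mfderiv 𝓘(ℝ, E) 𝓘(ℝ, E) (extChartAt 𝓘(ℝ, E) x) y) := by
        rw [mfderiv_comp y (c i).mdifferentiableAt (mdifferentiableAt_extChartAt h2),
          (c i).mfderiv_eq]
        rfl
      change mfderiv 𝓘(ℝ, E) 𝓘(ℝ, ℝ) (fun y => χ y • c i (extChartAt 𝓘(ℝ, E) x y)) y w = _
      rw [h3.mfderiv_eq, h4, TangentBundle.continuousLinearMapAt_trivializationAt h2]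
      rfl
    simp only [hd, T.localFrame_apply_of_mem_baseSet b hT]
    -- Expansion of `w` in the basis `b` after trivializing; the frame vectors are the images of `b`
    -- under the inverse trivialization.
    have hsum : T.symmL ℝ y (∑ i, b.coord i (T.continuousLinearMapAt ℝ y w) • b i) = w := by
      have := b.sum_repr (T.continuousLinearMapAt ℝ y w)
      simp only [Module.Basis.coord_apply]
      rw [this]
      exact T.symmL_continuousLinearMapAt hT w
    conv_lhs => rw [← hsum, map_sum, Finset.smul_sum]
    refine Finset.sum_congr rfl fun i _ => ?_
    rw [map_smul, smul_comm]
    congr 2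
    rw [Trivialization.basisAt, Module.Basis.map_apply, Trivialization.linearEquivAt_symm_apply,
      Trivialization.symmL_apply _ hT]

variable {F : Type u} [NormedAddCommGroup F] [NormedSpace ℝ F] {A : X → Type u}
  [∀ x, AddCommGroup (A x)] [∀ x, Module ℝ (A x)]
  [TopologicalSpace (TotalSpace F A)] [∀ x, TopologicalSpace (A x)]
  [FiberBundle F A] [VectorBundle ℝ F A]

/-- A section is smooth if locally some multiple of it by an invertible function is. -/
theorem contMDiff_of_smul (s : ∀ x, A x)
    (h : ∀ x, ∃ (ψ : Fun E X) (t : Sec E X F A), ψ x = 1 ∧ ∀ y, ψ y • s y = t y) :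
    ContMDiff 𝓘(ℝ, E) (𝓘(ℝ, E).prod 𝓘(ℝ, F)) ∞ (fun x => TotalSpace.mk' F x (s x)) := by
  intro x
  obtain ⟨ψ, t, hx, ht⟩ := h x
  have hψ : ContMDiffAt 𝓘(ℝ, E) 𝓘(ℝ, ℝ) ∞ (fun y => (ψ y)⁻¹) x :=
    (contDiffAt_inv ℝ (by simp [hx])).contMDiffAt.comp x (ψ.contMDiff x)
  refine (hψ.smul_section (t.contMDiff x)).congr_of_eventuallyEq ?_
  have hne : ∀ᶠ y in nhds x, ψ y ≠ 0 :=
    ψ.contMDiff.continuous.continuousAt.eventually_ne (by simp [hx])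
  filter_upwards [hne] with y hy
  have h1 : s y = (ψ y)⁻¹ • t y := by rw [← ht, smul_smul, inv_mul_cancel₀ hy, one_smul]
  exact congrArg (TotalSpace.mk' F y) h1

theorem sum_sec_apply {ι : Type*} (I : Finset ι) (s : ι → Sec E X F A) (x : X) :
    (∑ i ∈ I, s i) x = ∑ i ∈ I, s i x := by
  induction I using Finset.cons_induction with
  | empty => rfl
  | cons i I hi ih =>
    rw [Finset.sum_cons, Finset.sum_cons, ← ih]
    rfl

/-- Global form of `exists_local_frame`. -/
theorem exists_frame_coframe (x : X) :
    ∃ (ψ : Fun E X) (n : ℕ) (f : Fin n → Fun E X) (e : Fin n → VF E X), ψ x = 1 ∧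
      (∀ v : VF E X, ψ • v = ∑ i, act v (f i) • e i) ∧
      ∀ α : CoSec E X, ψ • α = ∑ i, pair α (e i) • dFun (f i) := by
  obtain ⟨ψ, n, f, e, hx, h⟩ := exists_local_frame (E := E) x
  refine ⟨ψ, n, f, e, hx, fun v => ?_, fun α => ?_⟩
  · ext y
    rw [sum_sec_apply]
    exact h y (v y)
  · refine ContMDiffSection.ext fun y => ContinuousLinearMap.ext fun w => ?_
    rw [sum_sec_apply]
    have h1 := congrArg (α y) (h y w)
    simp only [map_smul, map_sum] at h1
    rw [sum_apply]
    refine h1.trans (Finset.sum_congr rfl fun i _ => mul_comm _ _)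

theorem exists_vf_apply_eq (y : X) (w : TangentSpace 𝓘(ℝ, E) y) : ∃ v : VF E X, v y = w := by
  obtain ⟨ψ, n, f, e, hx, h⟩ := exists_local_frame (E := E) y
  refine ⟨∑ i, mvfderiv 𝓘(ℝ, E) (f i) y w • e i, ?_⟩
  rw [sum_sec_apply]
  exact (h y w).symm.trans (by rw [hx, one_smul])

/-- Tangent vectors are separated by the differentials of functions. -/
theorem tangent_ext {y : X} {w w' : TangentSpace 𝓘(ℝ, E) y}
    (h : ∀ f : Fun E X, mvfderiv 𝓘(ℝ, E) f y w = mvfderiv 𝓘(ℝ, E) f y w') : w = w' := by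
  obtain ⟨ψ, n, f, e, hx, hw⟩ := exists_local_frame (E := E) y
  have h1 := hw y w
  simp only [h] at h1
  rwa [← hw y w', hx, one_smul, one_smul] at h1

theorem vf_ext_act {v w : VF E X} (h : ∀ f, act v f = act w f) : v = w := by
  ext y
  exact tangent_ext fun f => congrArg (fun g : Fun E X => g y) (h f)

theorem coSec_ext_pair {α β : CoSec E X} (h : ∀ v, pair α v = pair β v) : α = β := by
  refine ContMDiffSection.ext fun y => ContinuousLinearMap.ext fun w => ?_
  obtain ⟨v, rfl⟩ := exists_vf_apply_eq y w
  exact congrArg (fun g : Fun E X => g y) (h v)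

/-- A tensorial operation on `1`-forms that kills exact forms is zero. -/
theorem eq_zero_of_dFun (T : CoSec E X → Sec E X F A) (hadd : ∀ α β, T (α + β) = T α + T β)
    (hsmul : ∀ (f : Fun E X) α, T (f • α) = f • T α) (hd : ∀ f, T (dFun f) = 0) (α : CoSec E X) :
    T α = 0 := by
  let T' : CoSec E X →ₗ[Fun E X] Sec E X F A := ⟨⟨T, hadd⟩, hsmul⟩
  ext x
  obtain ⟨ψ, n, f, e, hx, -, h⟩ := exists_frame_coframe (E := E) x
  have h1 : ψ • T α = 0 := by
    have h2 := congrArg T' (h α)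
    rw [map_smul, map_sum] at h2
    refine h2.trans (Finset.sum_eq_zero fun i _ => ?_)
    rw [map_smul]
    exact (congrArg (pair α (e i) • ·) (hd (f i))).trans (smul_zero _)
  have h2 : ψ x • T α x = 0 := congrArg (fun s : Sec E X F A => s x) h1
  rwa [hx, one_smul] at h2

variable (E X) in
-- A functional `Φ` is determined near a point by its values on a cut-off frame: `ψ Φ` is
-- represented by `∑ Φ(e_i) df_i`. These representatives fix a covector at each point, and the
-- covectors form a smooth section. Injectivity holds because every tangent vector extends to a
-- global field.
theorem pairing_bijective : Function.Bijective (pairing E X) := by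
  refine ⟨fun α β h => coSec_ext_pair fun v => congrArg (fun Φ => Φ v) h, fun Φ => ?_⟩
  have key (x : X) : ∃ (ψ : Fun E X) (θ : CoSec E X), ψ x = 1 ∧ ∀ v, pair θ v = ψ * Φ v := by
    obtain ⟨ψ, n, f, e, hx, h, -⟩ := exists_frame_coframe (E := E) x
    refine ⟨ψ, ∑ i, Φ (e i) • dFun (f i), hx, fun v => ?_⟩
    have h1 := congrArg Φ (h v)
    rw [map_smul, map_sum] at h1
    rw [← smul_eq_mul, h1, ← pairing_apply, map_sum, LinearMap.sum_apply]
    refine Finset.sum_congr rfl fun i _ => ?_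
    rw [pairing_apply, smul_pair, pair_dFun, map_smul, smul_eq_mul, mul_comm]
  choose ψ θ hψ hθ using key
  have hval (x : X) (v : VF E X) : θ x x (v x) = Φ v x := by
    have h1 := congrArg (fun g : Fun E X => g x) (hθ x v)
    exact h1.trans ((congrArg (· * Φ v x) (hψ x)).trans (one_mul _))
  -- The diagonal choice takes at each point the representative built around that point. It is
  -- smooth since `ψ x` times it is the single smooth form `θ x`.
  refine ⟨⟨fun x => θ x x, contMDiff_of_smul _ fun x => ⟨ψ x, θ x, hψ x, fun y => ?_⟩⟩, ?_⟩
  · ext w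
    obtain ⟨v, rfl⟩ := exists_vf_apply_eq y w
    have h1 := congrArg (fun g : Fun E X => g y) (hθ x v)
    refine Eq.trans ?_ h1.symm
    exact congrArg (ψ x y * ·) (hval y v)
  · ext v x
    exact hval x v

variable (E X) in
-- Same gluing with the roles exchanged: `ψ Φ` is evaluation on `∑ Φ(df_i) e_i`, and differentials
-- of functions suffice to separate tangent vectors.
theorem pairing_flip_bijective : Function.Bijective (pairing E X).flip := by
  refine ⟨fun v w h => vf_ext_act fun f => congrArg (fun Φ => Φ (dFun f)) h, fun Φ => ?_⟩
  have key (x : X) : ∃ (ψ : Fun E X) (θ : VF E X), ψ x = 1 ∧ ∀ α, pair α θ = ψ * Φ α := by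
    obtain ⟨ψ, n, f, e, hx, -, h⟩ := exists_frame_coframe (E := E) x
    refine ⟨ψ, ∑ i, Φ (dFun (f i)) • e i, hx, fun α => ?_⟩
    have h1 := congrArg Φ (h α)
    rw [map_smul, map_sum] at h1
    rw [← smul_eq_mul, h1, ← pairing_apply, map_sum]
    refine Finset.sum_congr rfl fun i _ => ?_
    rw [map_smul, map_smul, pairing_apply, smul_eq_mul, smul_eq_mul, mul_comm]
  choose ψ θ hψ hθ using key
  have hval (x : X) (α : CoSec E X) : α x (θ x x) = Φ α x := by
    have h1 := congrArg (fun g : Fun E X => g x) (hθ x α)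
    exact h1.trans ((congrArg (· * Φ α x) (hψ x)).trans (one_mul _))
  refine ⟨⟨fun x => θ x x, contMDiff_of_smul _ fun x => ⟨ψ x, θ x, hψ x, fun y => ?_⟩⟩, ?_⟩
  · refine tangent_ext fun f => ?_
    have h1 := congrArg (fun g : Fun E X => g y) (hθ x (dFun f))
    refine Eq.trans ?_ h1.symm
    rw [map_smul]
    exact congrArg (ψ x y * ·) (hval y (dFun f))
  · ext α x
    exact hval x α

end LocalCoframe

/-! ### The Koszul bracket and the Poisson Lie algebroid -/

section PoissonAlgebroid

variable {E : Type u} [NormedAddCommGroup E] [NormedSpace ℝ E] [FiniteDimensional ℝ E]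
  {X : Type u} [TopologicalSpace X] [ChartedSpace E X] [IsManifold 𝓘(ℝ, E) ∞ X]

theorem PoissonStructure.pair_sharp (P : PoissonStructure E X) (α β : CoSec E X) :
    pair β (onSec P.sharp α) = -pair α (onSec P.sharp β) := by
  ext x
  exact P.skew x (α x) (β x)

theorem PoissonStructure.pair_sharp_self (P : PoissonStructure E X) (α : CoSec E X) :
    pair α (onSec P.sharp α) = 0 := by
  ext x
  exact self_eq_neg.1 (P.skew x (α x) (α x))

theorem PoissonStructure.act_sharp_dFun (P : PoissonStructure E X) (f g : Fun E X) :
    act (onSec P.sharp (dFun f)) g = -act (onSec P.sharp (dFun g)) f := by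
  rw [← pair_dFun, P.pair_sharp, pair_dFun]

theorem PoissonStructure.act_jacobi (P : PoissonStructure E X) (f g h : Fun E X) :
    act (onSec P.sharp (dFun f)) (act (onSec P.sharp (dFun g)) h) +
      act (onSec P.sharp (dFun g)) (act (onSec P.sharp (dFun h)) f) +
      act (onSec P.sharp (dFun h)) (act (onSec P.sharp (dFun f)) g) = 0 := by
  ext x
  exact congrFun (P.jacobi f g h) x

/-- The exterior derivative of a `1`-form, evaluated on two vector fields. -/
def dOne (α : CoSec E X) (v w : VF E X) : Fun E X :=
  act v (pair α w) - act w (pair α v) - pair α (lie v w)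

theorem dOne_smul (α : CoSec E X) (f : Fun E X) (v w : VF E X) :
    dOne (f • α) v w = f * dOne α v w + (act v f * pair α w - act w f * pair α v) := by
  simp only [dOne, smul_pair, act_mul]
  ring

theorem dOne_add (α β : CoSec E X) (v w : VF E X) :
    dOne (α + β) v w = dOne α v w + dOne β v w := by
  simp only [dOne, add_pair, act_add]
  ring

theorem dOne_smul_real (c : ℝ) (α : CoSec E X) (v w : VF E X) :
    dOne (c • α) v w = c • dOne α v w := by
  simp only [dOne, smul_real_pair, act_smul_real, smul_sub]

theorem dOne_swap (α : CoSec E X) (v w : VF E X) : dOne α v w = -dOne α w v := by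
  rw [dOne, dOne, lie_swap, pair_neg]
  ring

theorem dOne_add_left (α : CoSec E X) (v v' w : VF E X) :
    dOne α (v + v') w = dOne α v w + dOne α v' w := by
  simp only [dOne, pair_add, act_add, add_act, add_lie]
  ring

/-- Tensoriality: the term in `act w f` from the derivative of `f α(v)` cancels the one from the
bracket. -/
theorem dOne_smul_left (α : CoSec E X) (f : Fun E X) (v w : VF E X) :
    dOne α (f • v) w = f * dOne α v w := by
  simp only [dOne, pair_smul, pair_add, act_mul, smul_act, smul_lie]
  ring

theorem dOne_add_right (α : CoSec E X) (v w w' : VF E X) :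
    dOne α v (w + w') = dOne α v w + dOne α v w' := by
  rw [dOne_swap, dOne_add_left, dOne_swap α v w, dOne_swap α v w']
  ring

theorem dOne_smul_right (α : CoSec E X) (f : Fun E X) (v w : VF E X) :
    dOne α v (f • w) = f * dOne α v w := by
  rw [dOne_swap, dOne_smul_left, dOne_swap α v w]
  ring

theorem dOne_self (α : CoSec E X) (v : VF E X) : dOne α v v = 0 := by
  ext x
  exact self_eq_neg.1 (congrArg (fun g : Fun E X => g x) (dOne_swap α v v))

theorem dOne_dFun (f : Fun E X) (v w : VF E X) : dOne (dFun f) v w = 0 := by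
  rw [dOne, pair_dFun, pair_dFun, pair_dFun, act_lie, sub_self]

variable [T2Space X]

variable (E X) in
/-- Smooth `1`-forms are the dual of vector fields. -/
def coSecEquiv : CoSec E X ≃ₗ[Fun E X] Module.Dual (Fun E X) (VF E X) :=
  LinearEquiv.ofBijective (pairing E X) (pairing_bijective E X)

theorem pair_coSecEquiv_symm (Φ : Module.Dual (Fun E X) (VF E X)) (v : VF E X) :
    pair ((coSecEquiv E X).symm Φ) v = Φ v :=
  congrArg (fun Ψ => Ψ v) ((coSecEquiv E X).apply_symm_apply Φ)

/-- The `1`-form `L_u β - ι_v dα`. -/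
def koszulForm (u v : VF E X) (α β : CoSec E X) : CoSec E X :=
  (coSecEquiv E X).symm
    -- Linear over functions in `w`, because the terms `u(f) β(w)` from the first two summands
    -- cancel; duality then gives a smooth 1-form.
    { toFun := fun w => act u (pair β w) - pair β (lie u w) - dOne α v w
      map_add' := fun w w' => by
        simp only [pair_add, act_add, lie_add, dOne_add_right]
        ring
      map_smul' := fun f w => by
        simp only [pair_smul, pair_add, act_mul, lie_smul, dOne_smul_right, smul_eq_mul,
          RingHom.id_apply]
        ring }

theorem pair_koszulForm (u v : VF E X) (α β : CoSec E X) (w : VF E X) :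
    pair (koszulForm u v α β) w = act u (pair β w) - pair β (lie u w) - dOne α v w :=
  pair_coSecEquiv_symm _ w

variable (P : PoissonStructure E X)

/-- Real scalars are constant functions, so real linearity follows from the Leibniz formulas, whose
derivative terms vanish. -/
theorem smul_real_eq {F : Type u} [NormedAddCommGroup F] [NormedSpace ℝ F] {A : X → Type u}
    [∀ x, AddCommGroup (A x)] [∀ x, Module ℝ (A x)]
    [TopologicalSpace (TotalSpace F A)] [∀ x, TopologicalSpace (A x)]
    [FiberBundle F A] [VectorBundle ℝ F A] (c : ℝ) (s : Sec E X F A) :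
    c • s = algebraMap ℝ (Fun E X) c • s := rfl

/-- The Koszul bracket `[α, β] = L_{Pα} β - ι_{Pβ} dα` of `1`-forms. -/
def koszulBracket : CoSec E X →ₗ[ℝ] CoSec E X →ₗ[ℝ] CoSec E X :=
  LinearMap.mk₂ ℝ (fun α β => koszulForm (onSec P.sharp α) (onSec P.sharp β) α β)
    (fun α α' β => coSec_ext_pair fun w => by
      simp only [add_pair, pair_koszulForm, map_add, add_act, add_lie, pair_add, dOne_add]
      ring)
    (fun c α β => coSec_ext_pair fun w => by
      simp only [smul_real_eq, smul_pair, pair_koszulForm, map_smul, smul_act, smul_lie, pair_add,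
        pair_smul, dOne_smul, act_algebraMap, neg_zero]
      ring)
    (fun α β β' => coSec_ext_pair fun w => by
      simp only [add_pair, pair_koszulForm, map_add, act_add, dOne_add_left]
      ring)
    (fun c α β => coSec_ext_pair fun w => by
      simp only [smul_real_eq, smul_pair, pair_koszulForm, map_smul, act_mul, act_algebraMap,
        dOne_smul_left]
      ring)

theorem pair_koszulBracket (α β : CoSec E X) (w : VF E X) :
    pair (koszulBracket P α β) w = act (onSec P.sharp α) (pair β w) -
      pair β (lie (onSec P.sharp α) w) - dOne α (onSec P.sharp β) w :=
  pair_koszulForm _ _ _ _ _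

/-- By Cartan's formula the bracket of `α` with itself is `d(α(Pα))`, and `α(Pα) = 0` by skewness.
-/
theorem koszulBracket_self (α : CoSec E X) : koszulBracket P α α = 0 := by
  refine coSec_ext_pair fun w => ?_
  have h0 : pair (0 : CoSec E X) w = 0 := rfl
  rw [pair_koszulBracket, dOne, P.pair_sharp_self, act_zero, h0]
  ring

theorem koszulBracket_swap (α β : CoSec E X) : koszulBracket P α β = -koszulBracket P β α := by
  have h := koszulBracket_self P (α + β)
  simp only [map_add, LinearMap.add_apply, koszulBracket_self, zero_add, add_zero] at h
  rw [add_comm] at h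
  exact eq_neg_of_add_eq_zero_left h

theorem koszulBracket_smul (α β : CoSec E X) (f : Fun E X) :
    koszulBracket P α (f • β) =
      f • koszulBracket P α β + act (onSec P.sharp α) f • β := by
  refine coSec_ext_pair fun w => ?_
  simp only [add_pair, smul_pair, pair_koszulBracket, map_smul, act_mul, dOne_smul_left]
  ring

/-- The Lie derivative commutes with `d`, and the contraction term vanishes by `d² = 0`. -/
theorem koszulBracket_dFun (f g : Fun E X) :
    koszulBracket P (dFun f) (dFun g) = dFun (act (onSec P.sharp (dFun f)) g) := by
  refine coSec_ext_pair fun w => ?_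
  rw [pair_koszulBracket, dOne_dFun, pair_dFun, pair_dFun, pair_dFun, act_lie]
  ring

/-- The defect `T` is tensorial in its second slot, as both sides satisfy the same Leibniz rule, and
skew, hence tensorial in both. On exact forms its vanishing says that the Hamiltonian field of `{f,
g}` is the commutator of those of `f` and `g`, which is the Jacobi identity. -/
theorem sharp_koszulBracket (α β : CoSec E X) :
    onSec P.sharp (koszulBracket P α β) = lie (onSec P.sharp α) (onSec P.sharp β) := by
  let T (α β : CoSec E X) : VF E X :=
    onSec P.sharp (koszulBracket P α β) - lie (onSec P.sharp α) (onSec P.sharp β)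
  have hadd (α β β') : T α (β + β') = T α β + T α β' := by
    simp only [T, map_add, lie_add]
    abel
  have hsmul (α) (f : Fun E X) (β) : T α (f • β) = f • T α β := by
    simp only [T, koszulBracket_smul, map_add, map_smul, lie_smul]
    module
  have hswap (α β) : T α β = -T β α := by
    simp only [T]
    rw [koszulBracket_swap, lie_swap, map_neg]
    abel
  have hexact (f g : Fun E X) : T (dFun f) (dFun g) = 0 := by
    rw [sub_eq_zero, koszulBracket_dFun]
    refine vf_ext_act fun h => ?_
    rw [act_lie, P.act_sharp_dFun _ h, ← sub_eq_zero]
    have h1 := P.act_jacobi f g h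
    rw [P.act_sharp_dFun h f, act_neg] at h1
    linear_combination -h1
  have hleft (f : Fun E X) (β) : T (dFun f) β = 0 :=
    eq_zero_of_dFun (T (dFun f)) (hadd _) (hsmul _) (hexact f) β
  refine sub_eq_zero.1 (eq_zero_of_dFun (T α) (hadd _) (hsmul _) (fun f => ?_) β)
  rw [hswap, hleft, neg_zero]

/-- The Jacobiator `J` is tensorial in its last slot: the second-order terms cancel because the
anchor preserves brackets. On exact forms it is the differential of the Jacobiator of the Poisson
bracket. -/
theorem koszulBracket_jacobi (α β γ : CoSec E X) :
    koszulBracket P α (koszulBracket P β γ) =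
      koszulBracket P (koszulBracket P α β) γ + koszulBracket P β (koszulBracket P α γ) := by
  let J (α β γ : CoSec E X) : CoSec E X :=
    koszulBracket P α (koszulBracket P β γ) -
      (koszulBracket P (koszulBracket P α β) γ + koszulBracket P β (koszulBracket P α γ))
  have hadd (α β γ γ') : J α β (γ + γ') = J α β γ + J α β γ' := by
    simp only [J, map_add]
    abel
  have hsmul (α β) (f : Fun E X) (γ) : J α β (f • γ) = f • J α β γ := by
    simp only [J, koszulBracket_smul, map_add, sharp_koszulBracket, act_lie]
    module
  have hswap (α β γ) : J α β γ = -J β α γ := by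
    simp only [J]
    rw [koszulBracket_swap P α β, map_neg, LinearMap.neg_apply]
    abel
  have hswap' (α β γ) : J α β γ = -J α γ β := by
    simp only [J]
    rw [koszulBracket_swap P γ β, koszulBracket_swap P γ (koszulBracket P α β),
      koszulBracket_swap P β (koszulBracket P α γ), map_neg]
    abel
  have hexact (f g h : Fun E X) : J (dFun f) (dFun g) (dFun h) = 0 := by
    simp only [J, koszulBracket_dFun]
    rw [sub_eq_zero]
    refine coSec_ext_pair fun w => ?_
    rw [add_pair, pair_dFun, pair_dFun, pair_dFun, ← act_add]
    congr 1
    have h1 := P.act_jacobi f g h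
    rw [P.act_sharp_dFun h f, act_neg] at h1
    rw [P.act_sharp_dFun (act (onSec P.sharp (dFun f)) g) h]
    linear_combination h1
  -- Exactness is dropped one argument at a time, using skew-symmetry to bring each remaining slot
  -- into last position.
  have h1 (f g : Fun E X) (γ) : J (dFun f) (dFun g) γ = 0 :=
    eq_zero_of_dFun _ (hadd _ _) (hsmul _ _) (hexact f g) γ
  have h2 (f : Fun E X) (β γ) : J (dFun f) β γ = 0 :=
    eq_zero_of_dFun _ (hadd _ _) (hsmul _ _) (fun g => by rw [hswap', h1, neg_zero]) γ
  refine sub_eq_zero.1 (eq_zero_of_dFun (J α β) (hadd _ _) (hsmul _ _) (fun f => ?_) γ)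
  rw [hswap', hswap, h2, neg_zero, neg_zero]

/-- The Poisson Lie algebroid structure on the cotangent bundle. -/
def poissonAlgebroid : LieAlgebroid E (E →L[ℝ] ℝ) (Cotangent E X) where
  anchor := P.sharp
  bracket := koszulBracket P
  bracket_self := koszulBracket_self P
  jacobi := koszulBracket_jacobi P
  leibniz := koszulBracket_smul P
  anchor_bracket := sharp_koszulBracket P

end PoissonAlgebroid

/-! ### Forms of degree at most three and the canonical 2-form -/

section CanonicalForm

variable {E : Type u} [NormedAddCommGroup E] [NormedSpace ℝ E] [FiniteDimensional ℝ E]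
  {X : Type u} [TopologicalSpace X] [ChartedSpace E X] [IsManifold 𝓘(ℝ, E) ∞ X]

theorem extD_eq_zero {η : PreForm E X} {b : ℕ} (h : ∀ v, η b v = 0) (v : Fin (b + 1) → VF E X) :
    extD η (b + 1) v = 0 := by
  simp only [extD, h, act_zero, Finset.sum_const_zero, sub_zero, mul_zero]

theorem extD_zero : extD (0 : PreForm E X) = 0 := by
  funext b v
  cases b with
  | zero => rfl
  | succ b => exact extD_eq_zero (fun _ => rfl) v

theorem lieD_eq_zero {w : VF E X} {η : PreForm E X} {b : ℕ} (h : ∀ v, η b v = 0)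
    (v : Fin b → VF E X) : lieD w η b v = 0 := by
  simp only [lieD, h, act_zero, Finset.sum_const_zero, sub_zero]

theorem lieD_zero (w : VF E X) : lieD w (0 : PreForm E X) = 0 := by
  funext b v
  exact lieD_eq_zero (fun _ => rfl) v

theorem contract_zero (w : VF E X) : contract w (0 : PreForm E X) = 0 := rfl

theorem dWedge_zero (f : Fun E X) : dWedge f (0 : PreForm E X) = 0 := by
  funext b v
  cases b with
  | zero => rfl
  | succ b => simp [dWedge]

/-- The exterior derivative of a `1`-form, as a form. -/
def dOneForm (α : CoSec E X) : PreForm E X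
  | 2, v => dOne α (v 0) (v 1)
  | _, _ => 0

theorem Ioi_zero_fin_two : Finset.Ioi (0 : Fin 2) = {1} := by decide
theorem Ioi_one_fin_two : Finset.Ioi (1 : Fin 2) = ∅ := by decide
theorem Ioi_zero_fin_three : Finset.Ioi (0 : Fin 3) = {1, 2} := by decide
theorem Ioi_one_fin_three : Finset.Ioi (1 : Fin 3) = {2} := by decide
theorem Ioi_two_fin_three : Finset.Ioi (2 : Fin 3) = ∅ := by decide

theorem extD_two (η : PreForm E X) (v : Fin 2 → VF E X) :
    extD η 2 v = act (v 0) (η 1 ![v 1]) - η 1 ![lie (v 0) (v 1)] - act (v 1) (η 1 ![v 0]) := by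
  change ∑ s : Fin 2, (-1) ^ (s : ℕ) * (act (v s) (η 1 (s.removeNth (n := 1) v)) -
    ∑ t ∈ Finset.Ioi s, η 1 (s.removeNth (n := 1) (Function.update v t (lie (v s) (v t))))) = _
  rw [Fin.sum_univ_two, Ioi_zero_fin_two, Ioi_one_fin_two, Finset.sum_singleton, Finset.sum_empty]
  have h0 : Fin.removeNth (n := 1) 0 v = ![v 1] := by ext i; fin_cases i; rfl
  have h1 : Fin.removeNth (n := 1) 1 v = ![v 0] := by ext i; fin_cases i; rfl
  have h2 : Fin.removeNth (n := 1) 0 (Function.update v 1 (lie (v 0) (v 1))) =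
      ![lie (v 0) (v 1)] := by ext i; fin_cases i; rfl
  rw [h0, h1, h2]
  simp only [Fin.val_zero, Fin.val_one]
  ring

theorem extD_three (η : PreForm E X) (v : Fin 3 → VF E X) :
    extD η 3 v = act (v 0) (η 2 ![v 1, v 2]) - η 2 ![lie (v 0) (v 1), v 2] -
      η 2 ![v 1, lie (v 0) (v 2)] - act (v 1) (η 2 ![v 0, v 2]) + η 2 ![v 0, lie (v 1) (v 2)] +
      act (v 2) (η 2 ![v 0, v 1]) := by
  change ∑ s : Fin 3, (-1) ^ (s : ℕ) * (act (v s) (η 2 (s.removeNth (n := 2) v)) -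
    ∑ t ∈ Finset.Ioi s, η 2 (s.removeNth (n := 2) (Function.update v t (lie (v s) (v t))))) = _
  rw [Fin.sum_univ_three, Ioi_zero_fin_three, Ioi_one_fin_three, Ioi_two_fin_three,
    Finset.sum_pair (by decide), Finset.sum_singleton, Finset.sum_empty]
  have h0 : Fin.removeNth (n := 2) 0 v = ![v 1, v 2] := by ext i; fin_cases i <;> rfl
  have h1 : Fin.removeNth (n := 2) 1 v = ![v 0, v 2] := by ext i; fin_cases i <;> rfl
  have h2 : Fin.removeNth (n := 2) 2 v = ![v 0, v 1] := by ext i; fin_cases i <;> rfl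
  have h3 : Fin.removeNth (n := 2) 0 (Function.update v 1 (lie (v 0) (v 1))) =
      ![lie (v 0) (v 1), v 2] := by ext i; fin_cases i <;> rfl
  have h4 : Fin.removeNth (n := 2) 0 (Function.update v 2 (lie (v 0) (v 2))) =
      ![v 1, lie (v 0) (v 2)] := by ext i; fin_cases i <;> rfl
  have h5 : Fin.removeNth (n := 2) 1 (Function.update v 2 (lie (v 1) (v 2))) =
      ![v 0, lie (v 1) (v 2)] := by ext i; fin_cases i <;> rfl
  rw [h0, h1, h2, h3, h4, h5]
  simp only [Fin.val_zero, Fin.val_one, Fin.val_two]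
  ring

theorem extD_toPreForm (α : CoSec E X) : extD (toPreForm α) = dOneForm α := by
  funext b v
  match b with
  | 0 => rfl
  | 1 => exact extD_eq_zero (fun _ => rfl) v
  | 2 =>
    rw [extD_two]
    change act (v 0) (pair α (v 1)) - pair α (lie (v 0) (v 1)) - act (v 1) (pair α (v 0)) =
      dOne α (v 0) (v 1)
    rw [dOne]
    ring
  | b + 3 => exact extD_eq_zero (fun _ => rfl) v

/-- Only degree 3 needs an argument: expanding, second derivatives cancel by the commutator formula
and nested brackets by the Jacobi identity. -/
theorem extD_dOneForm (α : CoSec E X) : extD (dOneForm α) = 0 := by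
  funext b v
  match b with
  | 0 => rfl
  | 1 => exact extD_eq_zero (fun _ => rfl) v
  | 2 => exact extD_eq_zero (fun _ => rfl) v
  | 3 =>
    rw [extD_three]
    change act (v 0) (dOne α (v 1) (v 2)) - dOne α (lie (v 0) (v 1)) (v 2) -
      dOne α (v 1) (lie (v 0) (v 2)) - act (v 1) (dOne α (v 0) (v 2)) +
      dOne α (v 0) (lie (v 1) (v 2)) + act (v 2) (dOne α (v 0) (v 1)) = 0
    simp only [dOne, act_sub, act_lie]
    rw [lie_jacobi (v 0) (v 1) (v 2), pair_add]
    ring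
  | b + 4 => exact extD_eq_zero (fun _ => rfl) v

theorem isDiffForm_zero : IsDiffForm (0 : PreForm E X) := fun _ => ⟨0, fun _ => rfl⟩

theorem isDiffForm_toPreForm (α : CoSec E X) : IsDiffForm (toPreForm α) := by
  intro b
  match b with
  | 0 => exact ⟨0, fun _ => rfl⟩
  | 1 => exact ⟨AlternatingMap.ofSubsingleton _ _ _ 0 (pairing E X α), fun v => rfl⟩
  | b + 2 => exact ⟨0, fun _ => rfl⟩

theorem isDiffForm_dOneForm (α : CoSec E X) : IsDiffForm (dOneForm α) := by
  intro b
  match b with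
  | 0 => exact ⟨0, fun _ => rfl⟩
  | 1 => exact ⟨0, fun _ => rfl⟩
  | 2 =>
    refine ⟨AlternatingMap.mk (MultilinearMap.mk' (fun v => dOne α (v 0) (v 1)) ?_ ?_) ?_,
      fun v => rfl⟩
    · intro v i x y
      fin_cases i
      · simp [dOne_add_left]
      · simp [dOne_add_right]
    · intro v i f x
      fin_cases i
      · simp [dOne_smul_left]
      · simp [dOne_smul_right]
    · intro v i j hij hne
      have h : v 0 = v 1 := by
        fin_cases i <;> fin_cases j <;> first | exact absurd rfl hne | exact hij | exact hij.symm
      change dOne α (v 0) (v 1) = 0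
      rw [h, dOne_self]
  | b + 3 => exact ⟨0, fun _ => rfl⟩

theorem dOneForm_add (α β : CoSec E X) : dOneForm (α + β) = dOneForm α + dOneForm β := by
  funext b v
  match b with
  | 0 | 1 | b + 3 => exact (add_zero _).symm
  | 2 => exact dOne_add α β _ _

theorem dOneForm_smul_real (c : ℝ) (α : CoSec E X) (b v) :
    dOneForm (c • α) b v = c • dOneForm α b v := by
  match b with
  | 0 | 1 | b + 3 => exact (smul_zero _).symm
  | 2 => exact dOne_smul_real c α _ _

/-- The rule `d(fα) = f dα + df ∧ α`, which is why the operator `d` has symbol the identity. -/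
theorem dOneForm_smul (f : Fun E X) (α : CoSec E X) (b v) :
    dOneForm (f • α) b v = f * dOneForm α b v + dWedge f (toPreForm α) b v := by
  match b with
  | 0 => simp [dOneForm, dWedge]
  | 1 => simp [dOneForm, dWedge, toPreForm]
  | 2 =>
    change dOne (f • α) (v 0) (v 1) = f * dOne α (v 0) (v 1) +
      ∑ s : Fin 2, (-1) ^ (s : ℕ) * (act (v s) f * pair α (s.removeNth (n := 1) v 0))
    rw [dOne_smul, Fin.sum_univ_two]
    have h0 : Fin.removeNth (n := 1) 0 v 0 = v 1 := rfl
    have h1 : Fin.removeNth (n := 1) 1 v 0 = v 0 := rfl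
    rw [h0, h1]
    simp only [Fin.val_zero, Fin.val_one]
    ring
  | b + 3 => simp [dOneForm, dWedge, toPreForm]

theorem toPreForm_add (α β : CoSec E X) : toPreForm (α + β) = toPreForm α + toPreForm β := by
  funext b v
  match b with
  | 0 | b + 2 => exact (add_zero _).symm
  | 1 => rfl

theorem toPreForm_smul (f : Fun E X) (α : CoSec E X) (b v) :
    toPreForm (f • α) b v = f * toPreForm α b v := by
  match b with
  | 0 | b + 2 => exact (mul_zero _).symm
  | 1 => rfl

theorem canonicalOp_one_zero (α : Fin 1 → CoSec E X) (β : Fin 0 → CoSec E X) :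
    canonicalOp E X 1 0 α β = dOneForm (α 0) := extD_toPreForm (α 0)

theorem canonicalOp_zero_one (α : Fin 0 → CoSec E X) (β : Fin 1 → CoSec E X) :
    canonicalOp E X 0 1 α β = toPreForm (β 0) := rfl

theorem canonicalOp_eq_zero {a i : ℕ} (h : a + i ≠ 1) (α : Fin a → CoSec E X)
    (β : Fin i → CoSec E X) : canonicalOp E X a i α β = 0 := by
  match a, i with
  | 0, 0 => rfl
  | 0, i + 2 => rfl
  | 1, i + 1 => rfl
  | a + 2, i => rfl
  | 1, 0 => exact absurd rfl h
  | 0, 1 => exact absurd rfl h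

theorem eq_of_add_eq_one {a i : ℕ} (h : a + i = 1) : (a = 1 ∧ i = 0) ∨ (a = 0 ∧ i = 1) := by
  omega

variable (E X) in
theorem isStackForm_canonicalOp : IsStackForm (canonicalOp E X) where
  left a i b β v := by
    by_cases h : a + i = 1
    · obtain ⟨rfl, rfl⟩ | ⟨rfl, rfl⟩ := eq_of_add_eq_one h
      · refine ⟨AlternatingMap.ofSubsingleton _ _ _ 0
          { toFun := fun α => dOneForm α b v
            map_add' := fun α β => ?_
            map_smul' := fun c α => dOneForm_smul_real c α b v }, fun α => ?_⟩
        · rw [dOneForm_add]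
          rfl
        · rw [canonicalOp_one_zero]
          rfl
      · exact ⟨AlternatingMap.constOfIsEmpty _ _ _ (toPreForm (β 0) b v), fun α => rfl⟩
    · exact ⟨0, fun α => by rw [canonicalOp_eq_zero h]; rfl⟩
  middle a i b α v := by
    by_cases h : a + i = 1
    · obtain ⟨rfl, rfl⟩ | ⟨rfl, rfl⟩ := eq_of_add_eq_one h
      · exact ⟨MultilinearMap.constOfIsEmpty _ _ (canonicalOp E X 1 0 α ![] b v), fun β => rfl⟩
      · refine ⟨MultilinearMap.ofSubsingleton _ _ _ 0
          { toFun := fun α => toPreForm α b v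
            map_add' := fun α β => ?_
            map_smul' := fun f α => toPreForm_smul f α b v }, fun α => rfl⟩
        rw [toPreForm_add]
        rfl
    · exact ⟨0, fun α => by rw [canonicalOp_eq_zero h]; rfl⟩
  symm a i α β τ := by
    by_cases h : a + i = 1
    · obtain ⟨rfl, rfl⟩ | ⟨rfl, rfl⟩ := eq_of_add_eq_one h <;>
        rw [Subsingleton.elim τ 1] <;> rfl
    · rw [canonicalOp_eq_zero h, canonicalOp_eq_zero h]
  right a i α β := by
    by_cases h : a + i = 1
    · obtain ⟨rfl, rfl⟩ | ⟨rfl, rfl⟩ := eq_of_add_eq_one h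
      · rw [canonicalOp_one_zero]
        exact isDiffForm_dOneForm _
      · exact isDiffForm_toPreForm _
    · rw [canonicalOp_eq_zero h]
      exact isDiffForm_zero
  symbol a i α x β f b v := by
    by_cases h : a + i = 0
    · obtain ⟨rfl, rfl⟩ : a = 0 ∧ i = 0 := by omega
      rw [canonicalOp_one_zero, canonicalOp_one_zero, canonicalOp_zero_one]
      exact dOneForm_smul f x b v
    · rw [canonicalOp_eq_zero (by omega), canonicalOp_eq_zero (by omega),
        canonicalOp_eq_zero (by omega), dWedge_zero]
      exact (by simp : (0 : Fun E X) = f * 0 + 0)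

variable (E X) in
/-- The canonical `2`-form of degree `1`. -/
def canonicalForm : StackForm E (E →L[ℝ] ℝ) (Cotangent E X) (2 + 0) (1 - (0 : ℕ)) where
  op := canonicalOp E X
  isStackForm := isStackForm_canonicalOp E X
  support a i b α β v hb := by
    by_cases h : a + i = 1
    · obtain ⟨rfl, rfl⟩ | ⟨rfl, rfl⟩ := eq_of_add_eq_one h
      · rw [canonicalOp_one_zero]
        match b with
        | 0 | 1 | b + 3 => rfl
        | 2 => exact absurd (by norm_num) hb
      · match b with
        | 0 | b + 2 => rfl
        | 1 => exact absurd (by norm_num) hb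
    · rw [canonicalOp_eq_zero h]
      rfl

end CanonicalForm

/-! ### The zero form on the stack -/

section Zero

variable {E : Type u} [NormedAddCommGroup E] [NormedSpace ℝ E] [FiniteDimensional ℝ E]
  {X : Type u} [TopologicalSpace X] [ChartedSpace E X] [IsManifold 𝓘(ℝ, E) ∞ X]
  {F : Type u} [NormedAddCommGroup F] [NormedSpace ℝ F] {A : X → Type u}
  [∀ x, AddCommGroup (A x)] [∀ x, Module ℝ (A x)]
  [TopologicalSpace (TotalSpace F A)] [∀ x, TopologicalSpace (A x)]
  [FiberBundle F A] [VectorBundle ℝ F A]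

instance (p : ℕ) (q : ℤ) : Zero (StackForm E F A p q) where
  zero :=
    { op := 0
      isStackForm :=
        { left := fun _ _ _ _ _ => ⟨0, fun _ => rfl⟩
          middle := fun _ _ _ _ _ => ⟨0, fun _ => rfl⟩
          symm := fun _ _ _ _ _ => rfl
          right := fun _ _ _ _ => isDiffForm_zero
          symbol := fun _ _ _ _ _ f _ _ => by
            simp only [Pi.zero_apply, mul_zero, zero_add]
            exact (congrFun (congrFun (dWedge_zero f) _) _).symm }
      support := fun _ _ _ _ _ _ _ => rfl }

theorem stackD_zero : stackD (0 : PreStackForm E F A) = 0 := by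
  funext a i α β
  cases i with
  | zero => simp [stackD, extD_zero]
  | succ i => simp [stackD, extD_zero]

variable [FiniteDimensional ℝ F] [ContMDiffVectorBundle ∞ F A 𝓘(ℝ, E)]

theorem stackCE_eq_zero (L : LieAlgebroid E F A) {c : PreStackForm E F A} {a i : ℕ}
    (h : ∀ α β, c a i α β = 0) (α β) : stackCE L c (a + 1) i α β = 0 := by
  simp only [stackCE, h, lieD_zero, Finset.sum_const_zero, sub_zero, smul_zero]

theorem stackContract_eq_zero (L : LieAlgebroid E F A) {c : PreStackForm E F A} {a i : ℕ}
    (h : ∀ α β, c a i α β = 0) (α β) : stackContract L c a (i + 1) α β = 0 := by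
  simp only [stackContract, h, contract_zero, Finset.sum_const_zero, smul_zero]

theorem stackDelta_zero (L : LieAlgebroid E F A) : stackDelta L (0 : PreStackForm E F A) = 0 := by
  funext a i α β
  have h1 : stackCE L (0 : PreStackForm E F A) a i α β = 0 := by
    cases a with
    | zero => rfl
    | succ a => exact stackCE_eq_zero L (fun _ _ => rfl) α β
  have h2 : stackContract L (0 : PreStackForm E F A) a i α β = 0 := by
    cases i with
    | zero => rfl
    | succ i => exact stackContract_eq_zero L (fun _ _ => rfl) α β
  exact (congrArg₂ (· + ·) h1 h2).trans (add_zero _)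

end Zero

/-! ### Closedness of the canonical form -/

section Closed

variable {E : Type u} [NormedAddCommGroup E] [NormedSpace ℝ E] [FiniteDimensional ℝ E]
  {X : Type u} [TopologicalSpace X] [ChartedSpace E X] [IsManifold 𝓘(ℝ, E) ∞ X]

theorem stackD_canonicalOp : stackD (canonicalOp E X) = 0 := by
  funext a i α β
  match a, i with
  | 0, 0 =>
    simp only [stackD, canonicalOp_eq_zero (show 0 + 0 ≠ 1 by decide), extD_zero, smul_zero]
    rfl
  | 1, 0 =>
    simp only [stackD, canonicalOp_one_zero, extD_dOneForm, smul_zero]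
    rfl
  | 0, 1 =>
    -- The de Rham derivative of the symbol cancels the operator `d` with `β` moved to the other
    -- group of arguments.
    change (-1 : ℤ) ^ 0 • extD (toPreForm (β 0)) - ∑ s : Fin 1,
      canonicalOp E X 1 0 (Fin.cons (β s) α) (s.removeNth (n := 0) β) = 0
    rw [Fin.sum_univ_one, canonicalOp_one_zero, extD_toPreForm, pow_zero, one_smul, Fin.cons_zero,
      sub_self]
  | a + 2, 0 =>
    simp only [stackD, canonicalOp_eq_zero (show a + 2 + 0 ≠ 1 by omega), extD_zero, smul_zero]
    rfl
  | a + 1, i + 1 =>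
    simp only [stackD, canonicalOp_eq_zero (show a + 1 + (i + 1) ≠ 1 by omega),
      canonicalOp_eq_zero (show a + 1 + 1 + i ≠ 1 by omega), extD_zero, smul_zero,
      Finset.sum_const_zero, sub_zero]
    rfl
  | 0, i + 2 =>
    simp only [stackD, canonicalOp_eq_zero (show 0 + (i + 1 + 1) ≠ 1 by omega),
      canonicalOp_eq_zero (show 0 + 1 + (i + 1) ≠ 1 by omega), extD_zero, smul_zero,
      Finset.sum_const_zero, sub_zero]
    rfl

variable [T2Space X]

theorem toPreForm_koszulBracket (P : PoissonStructure E X) (α β : CoSec E X) :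
    toPreForm (koszulBracket P α β) =
      lieD (onSec P.sharp α) (toPreForm β) -
        contract (onSec P.sharp β) (extD (toPreForm α)) := by
  rw [extD_toPreForm]
  funext b v
  match b with
  | 0 =>
    refine (?_ : (0 : Fun E X) = lieD _ (toPreForm β) 0 v - 0)
    rw [lieD_eq_zero (fun _ => rfl), sub_zero]
  | 1 =>
    change pair _ (v 0) = (act (onSec P.sharp α) (pair β (v 0)) - ∑ t : Fin 1,
      pair β (Function.update v t (lie (onSec P.sharp α) (v t)) 0)) -
        dOne α (onSec P.sharp β) (v 0)
    rw [pair_koszulBracket, Fin.sum_univ_one, Function.update_self]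
  | b + 2 =>
    refine (?_ : (0 : Fun E X) = lieD _ (toPreForm β) (b + 2) v - 0)
    rw [lieD_eq_zero (fun _ => rfl), sub_zero]

/-- Apply `d` to the bracket: `d` commutes with `L_{Pα}`, and `d ι_{Pβ} dα = L_{Pβ} dα` by Cartan's
formula. The proof checks this by expanding in degree 2. -/
theorem dOneForm_koszulBracket (P : PoissonStructure E X) (α β : CoSec E X) :
    dOneForm (koszulBracket P α β) =
      lieD (onSec P.sharp α) (dOneForm β) - lieD (onSec P.sharp β) (dOneForm α) := by
  funext b v
  match b with
  | 0 | 1 | b + 3 =>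
    refine (?_ : (0 : Fun E X) = lieD _ (dOneForm β) _ v - lieD _ (dOneForm α) _ v)
    rw [lieD_eq_zero (fun _ => rfl), lieD_eq_zero (fun _ => rfl), sub_zero]
  | 2 =>
    have h (u : VF E X) (γ : CoSec E X) : lieD u (dOneForm γ) 2 v =
        act u (dOne γ (v 0) (v 1)) - (dOne γ (lie u (v 0)) (v 1) + dOne γ (v 0) (lie u (v 1))) := by
      rw [lieD, Fin.sum_univ_two]
      rfl
    change dOne _ (v 0) (v 1) = lieD _ (dOneForm β) 2 v - lieD _ (dOneForm α) 2 v
    rw [h, h]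
    simp only [dOne, pair_koszulBracket, act_sub, act_lie,
      lie_jacobi (onSec P.sharp α) (v 0) (v 1), lie_jacobi (onSec P.sharp β) (v 0) (v 1), pair_add]
    ring

theorem stackDelta_canonicalOp (P : PoissonStructure E X) :
    stackDelta (poissonAlgebroid P) (canonicalOp E X) = 0 := by
  funext a i α β
  change stackCE (poissonAlgebroid P) (canonicalOp E X) a i α β +
    stackContract (poissonAlgebroid P) (canonicalOp E X) a i α β = 0
  match a, i with
  | 0, 0 => exact add_zero _
  | 0, 1 =>
    rw [stackContract_eq_zero _ (canonicalOp_eq_zero (by decide))]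
    exact add_zero _
  | 0, 2 =>
    -- Two symmetric arguments: the sum of the two contractions is the symmetric part of `P`, which
    -- is zero.
    change 0 + (-1 : ℤ) ^ 0 • ∑ s : Fin 2, contract (onSec P.sharp (β s))
      (toPreForm (s.removeNth (n := 1) β 0)) = 0
    have h0 : Fin.removeNth (n := 1) 0 β 0 = β 1 := rfl
    have h1 : Fin.removeNth (n := 1) 1 β 0 = β 0 := rfl
    rw [Fin.sum_univ_two, pow_zero, one_smul, zero_add, h0, h1]
    funext b v
    cases b with
    | zero =>
      change pair (β 1) (onSec P.sharp (β 0)) + pair (β 0) (onSec P.sharp (β 1)) = 0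
      rw [P.pair_sharp, neg_add_cancel]
    | succ b => exact add_zero _
  | 0, i + 3 =>
    rw [stackContract_eq_zero _ (canonicalOp_eq_zero (by omega))]
    exact add_zero _
  | 1, 0 =>
    rw [stackCE_eq_zero _ (canonicalOp_eq_zero (by decide))]
    exact add_zero _
  | 1, 1 =>
    -- One argument of each kind: the equation is exactly the formula for the bracket.
    change (∑ t : Fin 1, (-1 : ℤ) ^ (t : ℕ) • (lieD (onSec P.sharp (α t)) (toPreForm (β 0)) -
        ∑ s : Fin 1, toPreForm (Function.update β s (koszulBracket P (α t) (β s)) 0) -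
        ∑ s ∈ Finset.Ioi t, canonicalOp E X 0 1
          (t.removeNth (n := 0) (Function.update α s (koszulBracket P (α t) (α s)))) β)) +
      (-1 : ℤ) ^ 1 • ∑ s : Fin 1, contract (onSec P.sharp (β s))
        (canonicalOp E X 1 0 α (s.removeNth (n := 0) β)) = 0
    rw [Fin.sum_univ_one, Fin.sum_univ_one, Fin.sum_univ_one, Function.update_self,
      toPreForm_koszulBracket, canonicalOp_one_zero, extD_toPreForm,
      show Finset.Ioi (0 : Fin 1) = ∅ by decide, Finset.sum_empty, Fin.val_zero, pow_zero, pow_one,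
      one_smul, neg_smul, one_smul]
    abel
  | 1, i + 2 =>
    rw [stackCE_eq_zero _ (canonicalOp_eq_zero (by omega)),
      stackContract_eq_zero _ (canonicalOp_eq_zero (by omega)), add_zero]
  | 2, 0 =>
    -- Two alternating arguments: the equation is `dOneForm_koszulBracket`.
    change (∑ t : Fin 2, (-1 : ℤ) ^ (t : ℕ) •
      (lieD (onSec P.sharp (α t)) (canonicalOp E X 1 0 (t.removeNth (n := 1) α) β) -
        ∑ s : Fin 0, canonicalOp E X 1 0 (t.removeNth (n := 1) α)
          (Function.update β s (koszulBracket P (α t) (β s))) -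
        ∑ s ∈ Finset.Ioi t, canonicalOp E X 1 0
          (t.removeNth (n := 1) (Function.update α s (koszulBracket P (α t) (α s)))) β)) + 0 = 0
    simp only [canonicalOp_one_zero]
    have h0 : Fin.removeNth (n := 1) 0 α 0 = α 1 := rfl
    have h1 : Fin.removeNth (n := 1) 1 α 0 = α 0 := rfl
    have h2 : Fin.removeNth (n := 1) 0
        (Function.update α 1 (koszulBracket P (α 0) (α 1))) 0 = koszulBracket P (α 0) (α 1) := rfl
    rw [Fin.sum_univ_two, Ioi_zero_fin_two, Ioi_one_fin_two, Finset.sum_singleton,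
      Finset.sum_empty, h0, h1, h2, dOneForm_koszulBracket, Fin.val_zero, Fin.val_one, pow_zero,
      pow_one, one_smul, neg_smul, one_smul, Finset.univ_eq_empty, Finset.sum_empty,
      Finset.sum_empty]
    abel
  | a + 3, 0 =>
    rw [stackCE_eq_zero _ (canonicalOp_eq_zero (by omega))]
    exact add_zero _
  | a + 2, i + 1 =>
    rw [stackCE_eq_zero _ (canonicalOp_eq_zero (by omega)),
      stackContract_eq_zero _ (canonicalOp_eq_zero (by omega)), add_zero]

end Closed

/-! ### Quasi-isomorphisms between two-term complexes -/

section Complexes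

open HomologicalComplex

variable {C : Type*} [Category C] [Preadditive C] [Limits.HasZeroObject C]

theorem isIso_of_double {A₀ A₁ B₀ B₁ : C} {f : A₀ ⟶ A₁} {g : B₀ ⟶ B₁} {ι : Type*}
    {c : ComplexShape ι} {i₀ i₁ : ι} {hi : c.Rel i₀ i₁} (hne : i₀ ≠ i₁)
    (φ : double f hi ⟶ double g hi) (φ₀ : A₀ ⟶ B₀) (φ₁ : A₁ ⟶ B₁) (hφ₀ : IsIso φ₀) (hφ₁ : IsIso φ₁)
    (h₀ : φ.f i₀ = (doubleXIso₀ f hi).hom ≫ φ₀ ≫ (doubleXIso₀ g hi).inv)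
    (h₁ : φ.f i₁ = (doubleXIso₁ f hi hne).hom ≫ φ₁ ≫ (doubleXIso₁ g hi hne).inv) : IsIso φ := by
  have (i : ι) : IsIso (φ.f i) := by
    by_cases hi₀ : i = i₀
    · subst hi₀
      rw [h₀]
      infer_instance
    · by_cases hi₁ : i = i₁
      · subst hi₁
        rw [h₁]
        infer_instance
      · exact (isZero_double_X f hi i hi₀ hi₁).isIso (isZero_double_X g hi i hi₀ hi₁) _
  exact Hom.isIso_of_components φ

/-- A map from the complex `A → B` in degrees `0, 1` to `D` in degree `0` that is split by a
decomposition of `A` as the direct sum of `B` and `D` is a quasi-isomorphism. -/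
theorem quasiIso_double_single [CategoryWithHomology C] {A B D : C} (f : A ⟶ B)
    (hrel : (ComplexShape.up ℤ).Rel 0 1)
    (φ : double f hrel ⟶ (single C (ComplexShape.up ℤ) 0).obj D) (p : A ⟶ D)
    (hφ : φ.f 0 = (doubleXIso₀ f hrel).hom ≫ p ≫ (singleObjXSelf (ComplexShape.up ℤ) 0 D).inv)
    (σ : B ⟶ A) (τ : D ⟶ A) (hσ : σ ≫ f = 𝟙 B) (hτ : τ ≫ f = 0) (hp : τ ≫ p = 𝟙 D)
    (hsum : f ≫ σ + p ≫ τ = 𝟙 A) : QuasiIso φ := by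
  have h01 : (0 : ℤ) ≠ 1 := by decide
  -- The inclusion `τ` of the kernel is a chain map since `τ ≫ f = 0`, and a strict right inverse of
  -- the projection.
  let ψ : (single C (ComplexShape.up ℤ) 0).obj D ⟶ double f hrel :=
    mkHomFromSingle (τ ≫ (doubleXIso₀ f hrel).inv) (fun k hk => by
      obtain rfl : k = 1 := by simpa using hk.symm
      rw [double_d f hrel h01, Category.assoc, Iso.inv_hom_id_assoc, reassoc_of% hτ,
        Limits.zero_comp])
  have hψ : ψ.f 0 = (singleObjXSelf (ComplexShape.up ℤ) 0 D).hom ≫ τ ≫ (doubleXIso₀ f hrel).inv :=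
    mkHomFromSingle_f _ _
  have hinv : ψ ≫ φ = 𝟙 _ := by
    apply from_single_hom_ext
    rw [comp_f, hψ, hφ]
    simp [reassoc_of% hp]
  -- The homotopy is `-σ` from degree 1 to degree 0. The sign comes from `p ≫ τ - 𝟙 = -(f ≫ σ)` in
  -- degree 0 and from `-𝟙 = -(σ ≫ f)` in degree 1.
  let h (i j : ℤ) (_ : (ComplexShape.up ℤ).Rel j i) : (double f hrel).X i ⟶ (double f hrel).X j :=
    if hij : i = 1 ∧ j = 0 then
      eqToHom (by rw [hij.1]) ≫ (doubleXIso₁ f hrel h01).hom ≫ (-σ) ≫ (doubleXIso₀ f hrel).inv ≫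
        eqToHom (by rw [hij.2])
    else 0
  have h10 : h 1 0 hrel =
      (doubleXIso₁ f hrel h01).hom ≫ (-σ) ≫ (doubleXIso₀ f hrel).inv := by
    simp [h]
  have heq : φ ≫ ψ - 𝟙 _ = Homotopy.nullHomotopicMap' h := by
    ext
    · rw [Homotopy.nullHomotopicMap'_f (k₂ := -1) (k₁ := 0) (k₀ := 1) (by simp) hrel, h10,
        double_d f hrel h01, double_d_eq_zero₀ f hrel (-1) 0 (by decide), Limits.comp_zero, add_zero,
        sub_f_apply, comp_f, hφ, hψ, id_f]
      have h1 : p ≫ τ = 𝟙 A - f ≫ σ := by rw [← hsum]; abel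
      simp [reassoc_of% h1]
    · rw [Homotopy.nullHomotopicMap'_f (k₂ := 0) (k₁ := 1) (k₀ := 2) hrel (by simp), h10,
        double_d f hrel h01, double_d_eq_zero₀ f hrel 1 2 (by decide), Limits.zero_comp, zero_add,
        sub_f_apply, comp_f, id_f]
      have h1 : φ.f 1 = 0 := (isZero_single_obj_X _ 0 D 1 (by decide)).eq_of_tgt _ _
      simp [h1, reassoc_of% hσ]
  let e : HomotopyEquiv (double f hrel) ((single C (ComplexShape.up ℤ) 0).obj D) :=
    { hom := φ
      inv := ψ
      homotopyHomInvId := Homotopy.equivSubZero.symm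
        ((Homotopy.ofEq heq).trans (Homotopy.nullHomotopy' h))
      homotopyInvHomId := Homotopy.ofEq hinv }
  exact e.quasiIso_hom

end Complexes

/-! ### The symplectic and Lagrangian structures -/

section Main

variable {E : Type u} [NormedAddCommGroup E] [NormedSpace ℝ E] [FiniteDimensional ℝ E]
  {X : Type u} [TopologicalSpace X] [ChartedSpace E X] [IsManifold 𝓘(ℝ, E) ∞ X] [T2Space X]
  (P : PoissonStructure E X)

/-- The canonical closed `2`-form of degree `1` on the quotient stack of the Poisson algebroid. -/
def canonicalClosedForm : ClosedTwoForm (poissonAlgebroid P) 1 where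
  form
    | 0 => canonicalForm E X
    | _ + 1 => 0
  closed_zero := stackDelta_canonicalOp P
  closed_succ k := by
    have h : stackDelta (poissonAlgebroid P)
      (0 : PreStackForm E (E →L[ℝ] ℝ) (Cotangent E X)) = 0 := stackDelta_zero _
    cases k with
    | zero => exact (congrArg₂ (· + ·) stackD_canonicalOp h).trans (add_zero _)
    | succ k => exact (congrArg₂ (· + ·) stackD_zero h).trans (add_zero _)

theorem isIso_ofHom_of_bijective {R : Type*} [Ring R] {M N : Type u} [AddCommGroup M] [Module R M]
    [AddCommGroup N] [Module R N] (f : M →ₗ[R] N) (hf : Function.Bijective f) :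
    IsIso (ModuleCat.ofHom f) :=
  inferInstanceAs (IsIso (LinearEquiv.ofBijective f hf).toModuleIso.hom)

/-- The symbol pairing of the canonical form unfolds to `pairing`, so the map is an isomorphism in
both degrees; no condition on the rank of `P` enters. -/
theorem quasiIso_canonicalClosedForm_flat : QuasiIso (canonicalClosedForm P).flat := by
  have h0 : IsIso (ModuleCat.ofHom
      (symbolPairing ((canonicalClosedForm P).form 0).isStackForm)) :=
    isIso_ofHom_of_bijective _ (pairing_bijective E X)
  have h1 : IsIso (ModuleCat.ofHom
      (-(symbolPairing ((canonicalClosedForm P).form 0).isStackForm).flip)) :=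
    isIso_ofHom_of_bijective _ (neg_bijective.comp (pairing_flip_bijective E X))
  have : IsIso (canonicalClosedForm P).flat :=
    isIso_of_double (by decide) _ _ _ h0 h1
      (HomologicalComplex.mkHomFromDouble_f₀ _ _ _ _ _ _)
      (HomologicalComplex.mkHomFromDouble_f₁ _ _ _ _ _ _)
  infer_instance

/-- The canonical `1`-shifted symplectic structure. -/
def canonicalSymplectic : ShiftedSymplectic (poissonAlgebroid P) where
  toClosedTwoForm := canonicalClosedForm P
  nondegenerate := quasiIso_canonicalClosedForm_flat P

/-- The zero isotropic structure on the quotient map. -/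
def zeroIsotropic : Isotropic (canonicalClosedForm P) where
  form _ := 0
  eq_zero := rfl
  eq_succ _ := extD_zero

theorem zeroIsotropic_flatZero (v : VF E X) (α : CoSec E X) :
    (zeroIsotropic P).flatZero (v, α) = pairing E X α :=
  LinearMap.ext fun _ => sub_zero _

theorem quasiIso_zeroIsotropic_flat : QuasiIso (zeroIsotropic P).flat := by
  refine quasiIso_double_single _ _ _ (ModuleCat.ofHom (zeroIsotropic P).flatZero)
    (HomologicalComplex.mkHomFromDouble_f₀ _ _ _ _ _ _)
    -- The splitting: `v ↦ (v, 0)` is a section of `(v, α) ↦ v - Pα`, and `α ↦ (Pα, α)` parametrizes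
    -- its kernel.
    (ModuleCat.ofHom (LinearMap.inl (Fun E X) (VF E X) (CoSec E X)))
    (ModuleCat.ofHom (((onSec P.sharp).prod LinearMap.id).comp
      (coSecEquiv E X).symm.toLinearMap)) ?_ ?_ ?_ ?_
  · refine ModuleCat.hom_ext (LinearMap.ext fun v => ?_)
    change v - onSec P.sharp 0 = v
    rw [map_zero, sub_zero]
  · refine ModuleCat.hom_ext (LinearMap.ext fun Φ => ?_)
    exact sub_self (onSec P.sharp ((coSecEquiv E X).symm Φ))
  · refine ModuleCat.hom_ext (LinearMap.ext fun Φ => ?_)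
    exact (zeroIsotropic_flatZero P _ _).trans ((coSecEquiv E X).apply_symm_apply Φ)
  · refine ModuleCat.hom_ext (LinearMap.ext fun ⟨v, α⟩ => ?_)
    have h : (coSecEquiv E X).symm ((zeroIsotropic P).flatZero (v, α)) = α := by
      rw [zeroIsotropic_flatZero]
      exact (coSecEquiv E X).symm_apply_apply α
    change (v - onSec P.sharp α, (0 : CoSec E X)) +
      (onSec P.sharp ((coSecEquiv E X).symm ((zeroIsotropic P).flatZero (v, α))),
        (coSecEquiv E X).symm ((zeroIsotropic P).flatZero (v, α))) = (v, α)
    rw [h, Prod.mk_add_mk, sub_add_cancel, zero_add]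

/-- The zero Lagrangian structure on the quotient map. -/
def zeroLagrangian : Lagrangian (canonicalSymplectic P) where
  toIsotropic := zeroIsotropic P
  quasiIso := quasiIso_zeroIsotropic_flat P

end Main

end PoissonStack

end

theorem mainTheorem7 (E : Type u) [NormedAddCommGroup E] [NormedSpace ℝ E] [FiniteDimensional ℝ E]
    (X : Type u) [TopologicalSpace X] [ChartedSpace E X] [IsManifold 𝓘(ℝ, E) ∞ X]
    [T2Space X] [SecondCountableTopology X] (P : PoissonStack.PoissonStructure E X) :
    -- the Poisson Lie algebroid `T^*X`
    ∃ L : PoissonStack.LieAlgebroid E (E →L[ℝ] ℝ) (PoissonStack.Cotangent E X),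
      L.anchor = P.sharp ∧
      (∀ α β : PoissonStack.CoSec E X,
        PoissonStack.toPreForm (L.bracket α β) =
          PoissonStack.lieD (PoissonStack.onSec P.sharp α) (PoissonStack.toPreForm β) -
            PoissonStack.contract (PoissonStack.onSec P.sharp β)
              (PoissonStack.extD (PoissonStack.toPreForm α))) ∧
      -- the canonical `1`-shifted symplectic structure
      ∃ Ω : PoissonStack.ShiftedSymplectic L,
        (Ω.form 0).op = PoissonStack.canonicalOp E X ∧
        (∀ k, (Ω.form (k + 1)).op = 0) ∧
        -- the trivial Lagrangian structure on the quotient map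
        ∃ γ : PoissonStack.Lagrangian Ω,
          (∀ k, γ.form k = 0) ∧
          ∀ (v : PoissonStack.VF E X) (α : PoissonStack.CoSec E X) (w : PoissonStack.VF E X),
            γ.toIsotropic.flatZero (v, α) w = PoissonStack.pair α w :=
  ⟨PoissonStack.poissonAlgebroid P, rfl, PoissonStack.toPreForm_koszulBracket P,
    PoissonStack.canonicalSymplectic P, rfl, fun _ => rfl, PoissonStack.zeroLagrangian P,
    fun _ => rfl, fun v α w =>
      congrArg (fun Φ => Φ w) (PoissonStack.zeroIsotropic_flatZero P v α)⟩
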